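/- For integers $n\ge 1$ let $\mathcal D_n=\{(b,\dots,b)\}\subset\mathbb C^n$, let $\eta\colon\mathbb C^n\smallsetminus\mathcal D_n\to P(n)$ be the projection to the quotient by the action $Z\mapsto aZ+(b,\dots,b)$ ($a\in\mathbb C\smallsetminus\{0\}$, $b\in\mathbb C$) of the complex affine group, let $\mathbb L(n)\subset\mathbb C^n\smallsetminus\mathcal D_n$ be the set of $Z=(z_1,\dots,z_n)$ with $z_1,\dots,z_n$ collinear, let $\mu\colon P(n)\to P(n)$ be induced by $(z_1,z_2,\dots,z_n)\mapsto(z_2,\dots,z_n,z_1)$, and let $\mathscr L(n)=\eta(\mathbb L(n))/\langle\mu\rangle$ (so $\mathscr L(1)=\emptyset$ and $\mathscr L(2)$ is a point). Let $\mathcal R_n\in GL_{n-1}(\mathbb R)$ be the block diagonal matrix whose blocks are the rotation matrices of angles $m\cdot\frac{2\pi}{n}$, $1\le m\le\lfloor\frac{n-1}{2}\rfloor$ in increasing order, followed by a last entry $-1$ if $n$ is even. Let $\nu(X)=-X$, let $\mathbb S^{n-2}\subset\mathbb R^{n-1}$ be the unit sphere, and for $j\in\mathbb N$ put $$\ell^j(n)=\{X\in\mathbb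 S^{n-2}\colon \mathcal R_n^jX=X\ \text{or}\ \mathcal R_n^jX=-X\}.$$ For integers $q\ge1$ and $p_1,\dots,p_m$ with $\gcd(p_1,\dots,p_m,q)=1$, let $L_q(p_1,\dots,p_m)=\mathbb S^{2m-1}/\langle G\rangle$, where $\mathbb S^{2m-1}\subset\mathbb C^m$ is the unit sphere and $G(z_1,\dots,z_m)=(e^{2\pi i p_1/q}z_1,\dots,e^{2\pi i p_m/q}z_m)$ (for $m=0$ this space is empty). Let $\mathcal C_A=A\times[0,1]/(A\times\{1\})$ denote the closed cone over a space $A$, the cone over the empty space being one point. All quotients carry the quotient topology, and $\sqcup$ is the topological disjoint union. **Theorem.** Let $n\ge 3$, let $j$ be a positive divisor of $n$ with $j<n$, and let $k=n/j$. Then the quotient $\ell^j(n)/\langle\mathcal R_n,\nu\rangle$ is homeomorphic to: 1. $\mathscr L(j)$, if $k$ is odd; 2. $\mathscr L(j)\sqcup L_{2j}(1,3,5,\dots,j-1)$, if $k$ and $j$ are even; 3. $\mathscr L(j)\sqcup\big(\mathcal C_{L_j(1,3,\dots,j-2)}/\{([X],0)\sim([-X],0)\}\big)$, if $k$ is even and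 $j$ is odd, where $[X]\mapsto[-X]$ is the map of $L_j(1,3,\dots,j-2)$ induced by the antipodal map of the sphere $\mathbb S^{j-2}\subset\mathbb C^{(j-1)/2}$ (for $j=1$ the list of weights is empty, $L_1()=\emptyset$, and the second summand is one point). -/

import Mathlib

namespace NSegment

/-- The orbit space `S / Γ` of a (`Γ`-invariant) subset `S` of a space with an action of a group,
with the quotient of the subspace topology: two points of `S` are identified if and only if
they lie in the same `Γ`-orbit. -/
abbrev OrbitSpace {G X : Type*} [Group G] [MulAction G X] (Γ : Subgroup G) (S : Set X) : Type _ :=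
  Quotient ((MulAction.orbitRel Γ X).comap (Subtype.val : S → X))

section Shapes

/-- `ℂⁿ ∖ 𝒟ₙ`: the `n`-gons whose vertices do not all coincide. -/
abbrev Polygon (n : ℕ) : Type := {Z : Fin n → ℂ // ¬ ∃ b : ℂ, ∀ i, Z i = b}

/-- Equivalence under the complex affine group: `W = a Z + (b, …, b)` with `a ≠ 0`. -/
def affineSetoid (n : ℕ) : Setoid (Polygon n) where
  r Z W := ∃ a b : ℂ, a ≠ 0 ∧ ∀ i, W.1 i = a * Z.1 i + b
  iseqv :=
    { refl := fun Z => ⟨1, 0, one_ne_zero, fun i => by simp⟩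
      symm := by
        rintro Z W ⟨a, b, ha, h⟩
        refine ⟨a⁻¹, -(a⁻¹ * b), inv_ne_zero ha, fun i => ?_⟩
        rw [h i]
        field_simp
        ring
      trans := by
        rintro Z W V ⟨a, b, ha, h⟩ ⟨c, d, hc, h'⟩
        refine ⟨c * a, c * b + d, mul_ne_zero hc ha, fun i => ?_⟩
        rw [h' i, h i]
        ring }

/-- The space `P(n)` of shapes of `n`-gons with labelled vertices. -/
abbrev ShapeSpace (n : ℕ) : Type := Quotient (affineSetoid n)

/-- The natural projection `η : ℂⁿ ∖ 𝒟ₙ → P(n)`. -/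
def shape (n : ℕ) (Z : Polygon n) : ShapeSpace n := Quotient.mk (affineSetoid n) Z

/-- The (nondegenerate) `n`-segments: `n`-gons with collinear vertices. -/
def segments (n : ℕ) : Set (Polygon n) := {Z | Collinear ℝ (Set.range Z.1)}

/-- The cyclic relabelling `M (z₁, z₂, …, zₙ) = (z₂, …, zₙ, z₁)`. -/
def relabel (n : ℕ) : Equiv.Perm (Polygon n) where
  toFun Z := ⟨fun i => Z.1 (finRotate n i), fun ⟨b, hb⟩ =>
    Z.2 ⟨b, fun i => by
      have h : Z.1 (finRotate n ((finRotate n).symm i)) = b := hb ((finRotate n).symm i)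
      rwa [Equiv.apply_symm_apply] at h⟩⟩
  invFun Z := ⟨fun i => Z.1 ((finRotate n).symm i), fun ⟨b, hb⟩ =>
    Z.2 ⟨b, fun i => by
      have h : Z.1 ((finRotate n).symm (finRotate n i)) = b := hb (finRotate n i)
      rwa [Equiv.symm_apply_apply] at h⟩⟩
  left_inv Z := Subtype.ext (funext fun i => congrArg Z.1 ((finRotate n).apply_symm_apply i))
  right_inv Z := Subtype.ext (funext fun i => congrArg Z.1 ((finRotate n).symm_apply_apply i))

/-- The map `μ : P(n) → P(n)` with `μ ∘ η = η ∘ M`. -/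
def shapeRelabel (n : ℕ) : Equiv.Perm (ShapeSpace n) :=
  Quotient.congr (relabel n) fun Z W => by
    constructor
    · rintro ⟨a, b, ha, h⟩
      exact ⟨a, b, ha, fun i => h _⟩
    · rintro ⟨a, b, ha, h⟩
      exact ⟨a, b, ha, fun i => by
        have h' := h ((finRotate n).symm i)
        simp only [relabel, Equiv.coe_fn_mk, Equiv.apply_symm_apply] at h'
        exact h'⟩

/-- `ℒ(n) = η(𝕃(n)) / ⟨μ⟩`: the shapes of `n`-segments without labelled vertices. -/
abbrev UnlabelledShapes (n : ℕ) : Type :=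
  OrbitSpace (Subgroup.zpowers (shapeRelabel n)) (shape n '' segments n)

end Shapes

section Rotation

/-- The block matrix `𝓡ₙ` of size `n - 1`. The rows and columns `2m` and `2m + 1` (counted from `0`)
form the block given by the rotation matrix of angle `(m + 1) · 2π/n`. For even `n` the last row
`n - 2` is alone in its block, and the entry there is `cos π = -1`. -/
noncomputable def rotMatrix (n : ℕ) : Matrix (Fin (n - 1)) (Fin (n - 1)) ℝ := fun i l =>
  if i.1 / 2 = l.1 / 2 then
    if i = l then Real.cos ((i.1 / 2 + 1 : ℕ) * (2 * Real.pi / n))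
    else if i < l then -Real.sin ((i.1 / 2 + 1 : ℕ) * (2 * Real.pi / n))
    else Real.sin ((i.1 / 2 + 1 : ℕ) * (2 * Real.pi / n))
  else 0

theorem rotMatrix_mul_transpose (n : ℕ) : rotMatrix n * (rotMatrix n).transpose = 1 := by
  ext i l
  rw [Matrix.mul_apply, Matrix.one_apply]
  simp only [Matrix.transpose_apply]
  have hi := i.2
  have hl := l.2
  by_cases hb : i.1 / 2 = l.1 / 2
  · by_cases hp : 2 * (i.1 / 2) + 1 < n - 1
    · have hlt : 2 * (i.1 / 2) < n - 1 := by omega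
      rw [Fintype.sum_eq_add (⟨2 * (i.1 / 2), hlt⟩ : Fin (n - 1)) ⟨2 * (i.1 / 2) + 1, hp⟩]
      · have e1 : 2 * (i.1 / 2) / 2 = i.1 / 2 := by omega
        have e2 : (2 * (i.1 / 2) + 1) / 2 = i.1 / 2 := by omega
        have hcs := Real.sin_sq_add_cos_sq ((i.1 / 2 + 1 : ℕ) * (2 * Real.pi / n))
        simp only [rotMatrix, e1, e2, ← hb, if_true, Fin.ext_iff, Fin.lt_def]
        rcases Nat.mod_two_eq_zero_or_one i.1 with h | h <;>
        rcases Nat.mod_two_eq_zero_or_one l.1 with h' | h'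
        · have hi' : i.1 = 2 * (i.1 / 2) := by omega
          have hl' : l.1 = i.1 := by omega
          have c1 : i.1 ≠ 2 * (i.1 / 2) + 1 := by omega
          have c2 : i.1 < 2 * (i.1 / 2) + 1 := by omega
          simp only [hl', if_pos hi', if_neg c1, if_pos c2, if_true]
          linear_combination hcs
        · have hi' : i.1 = 2 * (i.1 / 2) := by omega
          have hl' : l.1 = 2 * (i.1 / 2) + 1 := by omega
          have c0 : i.1 ≠ l.1 := by omega
          have c1 : i.1 ≠ 2 * (i.1 / 2) + 1 := by omega
          have c2 : i.1 < 2 * (i.1 / 2) + 1 := by omega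
          have c3 : l.1 ≠ 2 * (i.1 / 2) := by omega
          have c4 : ¬ l.1 < 2 * (i.1 / 2) := by omega
          simp only [if_pos hi', if_pos hl', if_neg c0, if_neg c1, if_pos c2, if_neg c3, if_neg c4]
          ring
        · have hi' : i.1 = 2 * (i.1 / 2) + 1 := by omega
          have hl' : l.1 = 2 * (i.1 / 2) := by omega
          have c0 : i.1 ≠ l.1 := by omega
          have c1 : l.1 ≠ 2 * (i.1 / 2) + 1 := by omega
          have c2 : l.1 < 2 * (i.1 / 2) + 1 := by omega
          have c3 : i.1 ≠ 2 * (i.1 / 2) := by omega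
          have c4 : ¬ i.1 < 2 * (i.1 / 2) := by omega
          simp only [if_pos hi', if_pos hl', if_neg c0, if_neg c1, if_pos c2, if_neg c3, if_neg c4]
          ring
        · have hi' : i.1 = 2 * (i.1 / 2) + 1 := by omega
          have hl' : l.1 = i.1 := by omega
          have c3 : i.1 ≠ 2 * (i.1 / 2) := by omega
          have c4 : ¬ i.1 < 2 * (i.1 / 2) := by omega
          simp only [hl', if_pos hi', if_neg c3, if_neg c4, if_true]
          linear_combination hcs
      · simp [Fin.ext_iff]
      · rintro x ⟨h1, h2⟩
        have : ¬ i.1 / 2 = x.1 / 2 := by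
          simp only [ne_eq, Fin.ext_iff] at h1 h2
          omega
        simp [rotMatrix, this]
    · have hil : i = l := by
        apply Fin.ext
        omega
      subst hil
      rw [Fintype.sum_eq_single i]
      · have hn : ((i.1 / 2 + 1 : ℕ) : ℝ) * 2 = n := by
          have : (i.1 / 2 + 1) * 2 = n := by omega
          exact_mod_cast this
        have hn0 : (n : ℝ) ≠ 0 := by
          have : n ≠ 0 := by omega
          exact_mod_cast this
        have ha : ((i.1 / 2 + 1 : ℕ) : ℝ) * (2 * Real.pi / n) = Real.pi := by
          field_simp
          exact hn
        simp [rotMatrix, -Nat.cast_add, ha]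
      · intro x hx
        have : ¬ i.1 / 2 = x.1 / 2 := by
          simp only [ne_eq, Fin.ext_iff] at hx
          have := x.2
          omega
        simp [rotMatrix, this]
  · rw [if_neg (by rintro rfl; exact hb rfl)]
    apply Finset.sum_eq_zero
    intro x _
    by_cases hx : i.1 / 2 = x.1 / 2
    · have : ¬ l.1 / 2 = x.1 / 2 := by omega
      simp [rotMatrix, this]
    · simp [rotMatrix, hx]

/-- `𝓡ₙ` as a linear automorphism of `ℝⁿ⁻¹`. -/
noncomputable def rot (n : ℕ) :
    EuclideanSpace ℝ (Fin (n - 1)) ≃ₗ[ℝ] EuclideanSpace ℝ (Fin (n - 1)) :=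
  LinearEquiv.ofLinearMap (Matrix.toEuclideanLin (rotMatrix n))
    (Matrix.toEuclideanLin (rotMatrix n).transpose)
    (by rw [← Matrix.toLpLin_mul, rotMatrix_mul_transpose, Matrix.toLpLin_one])
    (by rw [← Matrix.toLpLin_mul, mul_eq_one_comm.mp (rotMatrix_mul_transpose n),
      Matrix.toLpLin_one])

/-- The group `⟨𝓡ₙ, ν⟩` of linear automorphisms of `ℝⁿ⁻¹`, where `ν(X) = -X`. -/
noncomputable def rotGroup (n : ℕ) :
    Subgroup (EuclideanSpace ℝ (Fin (n - 1)) ≃ₗ[ℝ] EuclideanSpace ℝ (Fin (n - 1))) :=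
  Subgroup.closure {rot n, LinearEquiv.neg ℝ}

/-- `ℓʲ(n)`: the points `X` of the unit sphere of `ℝⁿ⁻¹` with `𝓡ₙʲ X = X` or `𝓡ₙʲ X = -X`. -/
def fixedLocus (j n : ℕ) : Set (EuclideanSpace ℝ (Fin (n - 1))) :=
  {X | X ∈ Metric.sphere 0 1 ∧ ((rot n ^ j) X = X ∨ (rot n ^ j) X = -X)}

end Rotation

section Lens

/-- The map `G (z₁, …, zₘ) = (e^{2πi p₁/q} z₁, …, e^{2πi pₘ/q} zₘ)` of `ℂᵐ`. -/
noncomputable def lensMap {m : ℕ} (q : ℕ) (p : Fin m → ℤ) :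
    EuclideanSpace ℂ (Fin m) ≃ₗ[ℂ] EuclideanSpace ℂ (Fin m) where
  toFun z := WithLp.toLp 2 fun t => Complex.exp (2 * Real.pi * Complex.I * (p t / q)) * z t
  invFun z := WithLp.toLp 2 fun t => Complex.exp (-(2 * Real.pi * Complex.I * (p t / q))) * z t
  map_add' z w := by ext t; simp [mul_add]
  map_smul' c z := by ext t; simp; ring
  left_inv z := by ext t; simp [← mul_assoc, ← Complex.exp_add]
  right_inv z := by ext t; simp [← mul_assoc, ← Complex.exp_add]

/-- The orbifold lens space `L_q(p₁, …, pₘ) = 𝕊²ᵐ⁻¹ / ⟨G⟩`, for `q ≥ 1` and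
`gcd (p₁, …, pₘ, q) = 1`. -/
abbrev LensSpace {m : ℕ} (q : ℕ) (p : Fin m → ℤ) : Type :=
  OrbitSpace (Subgroup.zpowers (lensMap q p)) (Metric.sphere (0 : EuclideanSpace ℂ (Fin m)) 1)

/-- The map `[X] ↦ [-X]` of a lens space. -/
noncomputable def lensNeg {m : ℕ} (q : ℕ) (p : Fin m → ℤ) : LensSpace q p → LensSpace q p :=
  Quotient.map (fun X => -X) (by
    rintro X Y ⟨⟨g, hg⟩, h⟩
    refine ⟨⟨g, hg⟩, ?_⟩
    have h' : g Y.1 = X.1 := h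
    change g (-Y.1) = -X.1
    rw [map_neg, h'])

/-- The weights `(1, 3, …, 2m - 1)`. -/
def oddWeights (m : ℕ) : Fin m → ℤ := fun t => 2 * (t.1 : ℤ) + 1

end Lens

section Cone

/-- The relation that collapses `A × {1}` to the apex. -/
inductive ConeRel (A : Type*) : (A × unitInterval) ⊕ Unit → (A × unitInterval) ⊕ Unit → Prop
  | apex (a : A) : ConeRel A (Sum.inl (a, 1)) (Sum.inr ())

/-- The closed cone `A × [0, 1] / (A × {1})`. The apex is added as a separate point before
`A × {1}` is collapsed to it, which makes no difference unless `A` is empty;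
the cone over the empty space is one point. -/
abbrev Cone (A : Type*) [TopologicalSpace A] : Type _ := Quot (ConeRel A)

/-- The point `[a, s]` of the cone. -/
def Cone.mk {A : Type*} [TopologicalSpace A] (a : A) (s : unitInterval) : Cone A :=
  Quot.mk _ (Sum.inl (a, s))

/-- The relation that identifies each point `[a, 0]` of the base of the cone with `[τ a, 0]`. -/
inductive BaseRel {A : Type*} [TopologicalSpace A] (τ : A → A) : Cone A → Cone A → Prop
  | base (a : A) : BaseRel τ (Cone.mk a 0) (Cone.mk (τ a) 0)

/-- The cone over `A` with `[a, 0] ∼ [τ a, 0]` on its base. -/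
abbrev ConeModBase {A : Type*} [TopologicalSpace A] (τ : A → A) : Type _ := Quot (BaseRel τ)

end Cone

end NSegment

/-!
`ℓʲ(n)` is the disjoint union of two closed sets that are invariant under `𝓡ₙ` and `ν`: the unit
vectors fixed by `𝓡ₙʲ` and those negated by it. In complex coordinates on the blocks, `𝓡ₙ`
multiplies the coordinate of the `m`-th block by `ζᵐ`, with `ζ = exp (2πi / n)`.

*Fixed vectors.* For a suitable linear functional, the values at `X, 𝓡ₙ X, …, 𝓡ₙʲ⁻¹ X` of a fixed
vector `X` form a real `j`-tuple, and interpolation at the roots of unity shows that every real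
`j`-tuple arises from exactly one `X`, up to a translation. Hence the unit sphere of fixed vectors
parametrizes the `j`-segments up to translations and positive scaling; `𝓡ₙ` acts by relabelling, and
`ν` by the scaling factor `-1`.

*Negated vectors.* They exist only for `n = 2cj`, and they are supported on the blocks with
`m = c (2t + 1)`. There `𝓡ₙ` acts as the lens map of order `2j` with the odd weights, and `ν` is
`𝓡ₙʲ`. For odd `j` the last of these blocks is real, so these vectors form the unit sphere of
`ℂ⁽ʲ⁻¹⁾ᐟ² × ℝ`. The group is generated by `ν` and `𝓡ₙ²`, and `𝓡ₙ²` fixes the last coordinate. So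
the quotient is one of the upper hemisphere, which is a cone over the equator, and `ν` acts as the
antipodal map on the equator.
-/

open Topology

namespace NSegment

section Quotients

variable {X Y Z W : Type*} [TopologicalSpace X] [TopologicalSpace Y] [TopologicalSpace Z]
  [TopologicalSpace W]

/-- The homeomorphism between two quotients of a space by the same equivalence relation. -/
noncomputable def quotientHomeomorph {f : X → Y} {g : X → Z} (hf : IsQuotientMap f)
    (hg : IsQuotientMap g) (h : ∀ x y, f x = f y ↔ g x = g y) : Y ≃ₜ Z :=
  (IsQuotientMap.homeomorph (f := ⟨f, hf.continuous⟩) hf).symm.trans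
    ((Homeomorph.Quotient.congrRight h).trans
      (IsQuotientMap.homeomorph (f := ⟨g, hg.continuous⟩) hg))

theorem isQuotientMap_sumMap {f : X → Y} {g : Z → W} (hf : IsQuotientMap f)
    (hg : IsQuotientMap g) : IsQuotientMap (Sum.map f g) := by
  refine isQuotientMap_iff_isClosed.2 ⟨hf.surjective.sumMap hg.surjective, fun s => ?_⟩
  rw [isClosed_sum_iff, isClosed_sum_iff, ← hf.isClosed_preimage, ← hg.isClosed_preimage]
  rfl

theorem isOpenQuotientMap_quotientMk {s : Setoid X}
    (h : ∀ x y, s x y → ∃ φ : X → X, Continuous φ ∧ φ x = y ∧ ∀ z, s z (φ z)) :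
    IsOpenQuotientMap (Quotient.mk s) := by
  have hq : IsQuotientMap (Quotient.mk s) := isQuotientMap_quot_mk
  refine .of_isOpenMap_isQuotientMap (fun U hU => ?_) hq
  rw [← hq.isOpen_preimage, isOpen_iff_mem_nhds]
  rintro x ⟨u, hu, hux⟩
  obtain ⟨φ, hφ, rfl, hs⟩ := h x u (Quotient.exact hux.symm)
  filter_upwards [hφ.continuousAt.preimage_mem_nhds (hU.mem_nhds hu)] with z hz
  exact ⟨φ z, hz, (Quotient.sound (hs z)).symm⟩

theorem isQuotientMap_comp_of_range_union_image {φ : Y → Z} (hφ : IsQuotientMap φ) {σ : Y → Y}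
    (hσ : IsClosedMap σ) (hφσ : ∀ y, φ (σ y) = φ y) {h : X → Y} (hc : Continuous h)
    (hh : IsClosedMap h) (hcover : Set.range h ∪ σ '' Set.range h = Set.univ) :
    IsQuotientMap (φ ∘ h) := by
  refine isQuotientMap_iff_isClosed.2 ⟨fun z => ?_, fun C => ⟨?_, fun hC => ?_⟩⟩
  · obtain ⟨y, rfl⟩ := hφ.surjective z
    rcases hcover.symm ▸ Set.mem_univ y with ⟨x, rfl⟩ | ⟨_, ⟨x, rfl⟩, rfl⟩
    exacts [⟨x, rfl⟩, ⟨x, (hφσ _).symm⟩]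
  · exact fun hC => hC.preimage (hφ.continuous.comp hc)
  · have preimage_eq : φ ⁻¹' C = h '' (φ ∘ h ⁻¹' C) ∪ σ '' (h '' (φ ∘ h ⁻¹' C)) := by
      ext y
      constructor
      · intro hy
        rcases hcover.symm ▸ Set.mem_univ y with ⟨x, rfl⟩ | ⟨_, ⟨x, rfl⟩, rfl⟩
        · exact Or.inl ⟨x, hy, rfl⟩
        · exact Or.inr ⟨h x, ⟨x, by rwa [Set.mem_preimage, hφσ] at hy, rfl⟩, rfl⟩
      · rintro (⟨x, hx, rfl⟩ | ⟨_, ⟨x, hx, rfl⟩, rfl⟩)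
        exacts [hx, by rwa [Set.mem_preimage, hφσ]]
    rw [← hφ.isClosed_preimage, preimage_eq]
    exact (hh _ hC).union (hσ _ (hh _ hC))

end Quotients

theorem apply_zpow_smul_of_semiconj {G H X Y : Type*} [Group G] [Group H] [MulAction G X]
    [MulAction H Y] {g : G} {h : H} {f : X → Y} (hf : ∀ x, f (g • x) = h • f x) (i : ℤ) (x : X) :
    f (g ^ i • x) = h ^ i • f x := by
  induction i using Int.induction_on generalizing x with
  | zero => simp
  | succ i ih => rw [zpow_add_one, zpow_add_one, mul_smul, mul_smul, ih, hf]
  | pred i ih =>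
    rw [zpow_sub_one, zpow_sub_one, mul_smul, mul_smul, ih, eq_inv_smul_iff.2 (hf (g⁻¹ • x)).symm,
      smul_inv_smul]

section OrbitSpace

variable {G X : Type*} [Group G] [MulAction G X] (Γ : Subgroup G)

/-- The class of a point of `S` in the orbit space. -/
def OrbitSpace.mk {S : Set X} (x : S) : OrbitSpace Γ S := Quotient.mk _ x

theorem OrbitSpace.mk_eq_mk {S : Set X} {x y : S} :
    OrbitSpace.mk Γ x = OrbitSpace.mk Γ y ↔ ∃ g ∈ Γ, g • (y : X) = x := by
  refine Quotient.eq.trans ?_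
  change (∃ g : Γ, g • (y : X) = x) ↔ _
  simp [Subgroup.smul_def]

variable [TopologicalSpace X]

theorem OrbitSpace.isQuotientMap_mk (S : Set X) :
    IsQuotientMap (OrbitSpace.mk Γ : S → OrbitSpace Γ S) :=
  isQuotientMap_quot_mk

theorem OrbitSpace.isOpenQuotientMap_mk {S : Set X}
    (hc : ∀ g ∈ Γ, Continuous fun x : X => g • x) (hS : ∀ g ∈ Γ, ∀ x ∈ S, g • x ∈ S) :
    IsOpenQuotientMap (OrbitSpace.mk Γ : S → OrbitSpace Γ S) := by
  refine isOpenQuotientMap_quotientMk fun x y h => ?_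
  obtain ⟨g, hg⟩ := Setoid.symm' _ h
  refine ⟨fun z => ⟨g.1 • z.1, hS g.1 g.2 z z.2⟩, ?_, Subtype.ext hg, fun z => ?_⟩
  · exact ((hc g.1 g.2).comp continuous_subtype_val).subtype_mk _
  · exact Setoid.symm' _ ⟨g, rfl⟩

/-- An orbit space splits along a decomposition into disjoint closed invariant subsets. -/
noncomputable def OrbitSpace.homeomorphSum {S A B : Set X} (hS : S = A ∪ B) (hA : IsClosed A)
    (hB : IsClosed B) (hAB : Disjoint A B) (hinv : ∀ g ∈ Γ, ∀ x ∈ A, g • x ∈ A) :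
    OrbitSpace Γ S ≃ₜ OrbitSpace Γ A ⊕ OrbitSpace Γ B :=
  have hAS : A ⊆ S := hS ▸ Set.subset_union_left
  have hBS : B ⊆ S := hS ▸ Set.subset_union_right
  have hcover : IsQuotientMap (Sum.elim (Set.inclusion hAS) (Set.inclusion hBS)) := by
    refine IsClosedMap.isQuotientMap
      ((hA.isClosedMap_inclusion hAS).sumElim (hB.isClosedMap_inclusion hBS))
      ((continuous_inclusion hAS).sumElim (continuous_inclusion hBS)) fun ⟨x, hx⟩ => ?_
    rcases hS ▸ hx with h | h
    exacts [⟨Sum.inl ⟨x, h⟩, rfl⟩, ⟨Sum.inr ⟨x, h⟩, rfl⟩]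
  have hcross : ∀ (a : A) (b : B), ∀ g ∈ Γ, g • (a : X) ≠ b := fun a b g hg h =>
    Set.disjoint_left.1 hAB (hinv g hg a.1 a.2) (h ▸ b.2)
  quotientHomeomorph ((isQuotientMap_mk Γ S).comp hcover)
    (isQuotientMap_sumMap (isQuotientMap_mk Γ A) (isQuotientMap_mk Γ B)) <| by
      rintro (x | x) (y | y)
      · simp [mk_eq_mk]
      · have : ∀ g ∈ Γ, g • (y : X) ≠ x := fun g hg h =>
          hcross x y g⁻¹ (inv_mem hg) (inv_smul_eq_iff.2 h.symm)
        simpa [mk_eq_mk] using this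
      · simpa [mk_eq_mk] using hcross y x
      · simp [mk_eq_mk]

end OrbitSpace

section Coordinates

/-- The `i`-th coordinate, which is zero for `i ≥ N`. -/
noncomputable def extCoord {N : ℕ} (i : ℕ) : EuclideanSpace ℝ (Fin N) →ₗ[ℝ] ℝ :=
  if h : i < N then EuclideanSpace.projₗ ⟨i, h⟩ else 0

theorem extCoord_val {N : ℕ} (i : Fin N) (X : EuclideanSpace ℝ (Fin N)) :
    extCoord i.1 X = X i := by
  simp [extCoord]

theorem extCoord_of_le {N i : ℕ} (h : N ≤ i) (X : EuclideanSpace ℝ (Fin N)) :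
    extCoord i X = 0 := by
  simp [extCoord, h.not_gt]

theorem extCoord_eq_sum {N : ℕ} (i : ℕ) (X : EuclideanSpace ℝ (Fin N)) :
    extCoord i X = ∑ l : Fin N, if l.1 = i then X l else 0 := by
  by_cases h : i < N
  · lift i to Fin N using h
    simp [extCoord_val, Fin.val_inj]
  · rw [extCoord_of_le (not_lt.1 h), Finset.sum_eq_zero fun l _ => if_neg (by omega)]

/-- The complex coordinate in the `m`-th block (counted from `0`) of `𝓡ₙ`, where `N = n - 1`. The
last block is real if `n` is even. -/
noncomputable def coord {N : ℕ} (m : ℕ) : EuclideanSpace ℝ (Fin N) →ₗ[ℝ] ℂ where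
  toFun X := ⟨extCoord (2 * m) X, extCoord (2 * m + 1) X⟩
  map_add' X Y := by apply Complex.ext <;> simp
  map_smul' a X := by apply Complex.ext <;> simp

theorem coord_re {N m : ℕ} (X : EuclideanSpace ℝ (Fin N)) :
    (coord m X).re = extCoord (2 * m) X := rfl

theorem coord_im {N m : ℕ} (X : EuclideanSpace ℝ (Fin N)) :
    (coord m X).im = extCoord (2 * m + 1) X := rfl

variable {n : ℕ}

theorem coord_im_of_last {m : ℕ} (hm : 2 * m + 2 = n) (X : EuclideanSpace ℝ (Fin (n - 1))) :
    (coord m X).im = 0 :=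
  extCoord_of_le (by omega) X

theorem coord_ext {X Y : EuclideanSpace ℝ (Fin (n - 1))}
    (h : ∀ m < n / 2, coord m X = coord m Y) : X = Y := by
  ext i
  have hm := Complex.ext_iff.1 (h (i.1 / 2) (by omega))
  simp only [coord_re, coord_im] at hm
  rw [← extCoord_val, ← extCoord_val]
  rcases Nat.even_or_odd' i.1 with ⟨m, hi | hi⟩
  · rw [show 2 * (i.1 / 2) = i.1 by omega] at hm
    exact hm.1
  · rw [show 2 * (i.1 / 2) + 1 = i.1 by omega] at hm
    exact hm.2

theorem sum_range_two_mul {M : Type*} [AddCommMonoid M] (f : ℕ → M) (N : ℕ) :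
    ∑ i ∈ Finset.range (2 * N), f i = ∑ m ∈ Finset.range N, (f (2 * m) + f (2 * m + 1)) := by
  induction N with
  | zero => simp
  | succ N ih =>
    rw [Finset.sum_range_succ, ← ih, Nat.mul_succ, Finset.sum_range_succ, Finset.sum_range_succ,
      add_assoc]

theorem norm_sq_eq_sum_coord (X : EuclideanSpace ℝ (Fin (n - 1))) :
    ‖X‖ ^ 2 = ∑ m ∈ Finset.range (n / 2), ‖coord m X‖ ^ 2 := calc
  ‖X‖ ^ 2 = ∑ i : Fin (n - 1), extCoord i.1 X ^ 2 := by
    simp [EuclideanSpace.norm_sq_eq, extCoord_val]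
  _ = ∑ i ∈ Finset.range (n - 1), extCoord i X ^ 2 :=
    Fin.sum_univ_eq_sum_range (fun i => extCoord i X ^ 2) _
  _ = ∑ i ∈ Finset.range (2 * (n / 2)), extCoord i X ^ 2 := by
    refine Finset.sum_subset (Finset.range_subset_range.2 (by omega)) fun i _ hi => ?_
    rw [extCoord_of_le (by simpa using hi), zero_pow two_ne_zero]
  _ = ∑ m ∈ Finset.range (n / 2), ‖coord m X‖ ^ 2 := by
    simp only [sum_range_two_mul, Complex.sq_norm, Complex.normSq_apply, coord_re, coord_im, ← sq]

/-- The vector of `ℝⁿ⁻¹` with prescribed complex coordinates (the imaginary part of the last one is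
dropped if `n` is even). -/
noncomputable def ofCoord (n : ℕ) (d : ℕ → ℂ) : EuclideanSpace ℝ (Fin (n - 1)) :=
  WithLp.toLp 2 fun i => if i.1 % 2 = 0 then (d (i.1 / 2)).re else (d (i.1 / 2)).im

theorem coord_ofCoord {m : ℕ} {d : ℕ → ℂ} (hm : m < n / 2)
    (hd : 2 * m + 2 = n → (d m).im = 0) : coord m (ofCoord n d) = d m := by
  apply Complex.ext
  · rw [coord_re, extCoord, dif_pos (by omega)]
    simp [ofCoord]
  · rw [coord_im]
    rcases lt_or_ge (2 * m + 1) (n - 1) with h | h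
    · rw [extCoord, dif_pos h]
      simp [ofCoord, show (2 * m + 1) / 2 = m by omega]
    · rw [extCoord_of_le h, hd (by omega)]

end Coordinates

section Rotation

variable {n : ℕ}

/-- The primitive `n`-th root of unity `e^{2πi/n}`. -/
noncomputable def zeta (n : ℕ) : ℂ := Complex.exp (2 * Real.pi * Complex.I / n)

theorem zeta_isPrimitiveRoot (hn : n ≠ 0) : IsPrimitiveRoot (zeta n) n :=
  Complex.isPrimitiveRoot_exp n hn

theorem zeta_pow_eq_exp (m : ℕ) :
    zeta n ^ m = Complex.exp ((m * (2 * Real.pi / n) : ℝ) * Complex.I) := by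
  rw [zeta, ← Complex.exp_nat_mul]
  push_cast
  ring_nf

theorem norm_zeta_pow (m : ℕ) : ‖zeta n ^ m‖ = 1 := by
  rw [zeta_pow_eq_exp, Complex.norm_exp_ofReal_mul_I]

theorem zeta_two_mul_pow (hn : n ≠ 0) : zeta (2 * n) ^ n = -1 := by
  rw [zeta_pow_eq_exp, ← Complex.exp_pi_mul_I]
  congr 3
  push_cast
  field_simp

theorem sum_mul_eq_of_block {N m : ℕ} {c : Fin N → ℝ} {a b : ℝ} (ha : ∀ l, l.1 = 2 * m → c l = a)
    (hb : ∀ l, l.1 = 2 * m + 1 → c l = b) (hc : ∀ l, l.1 / 2 ≠ m → c l = 0)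
    (X : EuclideanSpace ℝ (Fin N)) :
    ∑ l, c l * X l = a * extCoord (2 * m) X + b * extCoord (2 * m + 1) X := by
  rw [extCoord_eq_sum, extCoord_eq_sum, Finset.mul_sum, Finset.mul_sum, ← Finset.sum_add_distrib]
  refine Finset.sum_congr rfl fun l _ => ?_
  rcases eq_or_ne l.1 (2 * m) with h | h
  · simp [h, ha l h]
  rcases eq_or_ne l.1 (2 * m + 1) with h' | h'
  · simp [h', hb l h']
  · simp [h, h', hc l (by omega)]

theorem extCoord_two_mul_rot (m : ℕ) (hm : 2 * m < n - 1) (X : EuclideanSpace ℝ (Fin (n - 1))) :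
    extCoord (2 * m) (rot n X) = (zeta n ^ (m + 1)).re * extCoord (2 * m) X -
      (zeta n ^ (m + 1)).im * extCoord (2 * m + 1) X := by
  rw [sub_eq_add_neg, ← neg_mul, zeta_pow_eq_exp, Complex.exp_ofReal_mul_I_re,
    Complex.exp_ofReal_mul_I_im]
  refine (extCoord_val ⟨2 * m, hm⟩ _).trans (sum_mul_eq_of_block ?_ ?_ ?_ X) <;> intro l hl
  all_goals simp only [rotMatrix, Fin.ext_iff, Fin.lt_def, show 2 * m / 2 = m by omega]
  · rw [if_pos (by omega), if_pos hl.symm]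
  · rw [if_pos (by omega), if_neg (by omega), if_pos (by omega)]
  · rw [if_neg hl.symm]

theorem extCoord_two_mul_add_one_rot (m : ℕ) (hm : 2 * m + 1 < n - 1)
    (X : EuclideanSpace ℝ (Fin (n - 1))) :
    extCoord (2 * m + 1) (rot n X) = (zeta n ^ (m + 1)).im * extCoord (2 * m) X +
      (zeta n ^ (m + 1)).re * extCoord (2 * m + 1) X := by
  rw [zeta_pow_eq_exp, Complex.exp_ofReal_mul_I_re, Complex.exp_ofReal_mul_I_im]
  refine (extCoord_val ⟨2 * m + 1, hm⟩ _).trans (sum_mul_eq_of_block ?_ ?_ ?_ X) <;> intro l hl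
  all_goals simp only [rotMatrix, Fin.ext_iff, Fin.lt_def, show (2 * m + 1) / 2 = m by omega]
  · rw [if_pos (by omega), if_neg (by omega), if_neg (by omega)]
  · rw [if_pos (by omega), if_pos hl.symm]
  · rw [if_neg hl.symm]

theorem coord_rot (m : ℕ) (X : EuclideanSpace ℝ (Fin (n - 1))) :
    coord m (rot n X) = zeta n ^ (m + 1) * coord m X := by
  rcases le_or_gt (n - 1) (2 * m) with hm | hm
  · apply Complex.ext <;> simp [coord_re, coord_im, extCoord_of_le hm,
      extCoord_of_le (hm.trans (Nat.le_succ _))]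
  apply Complex.ext
  · rw [coord_re, extCoord_two_mul_rot m hm, Complex.mul_re, coord_re, coord_im]
  rcases lt_or_ge (2 * m + 1) (n - 1) with hm' | hm'
  · rw [coord_im, extCoord_two_mul_add_one_rot m hm', Complex.mul_im, coord_re, coord_im, add_comm]
  · obtain rfl : 2 * (m + 1) = n := by omega
    rw [coord_im_of_last rfl, zeta_two_mul_pow m.succ_ne_zero, neg_one_mul, Complex.neg_im,
      coord_im_of_last rfl, neg_zero]

theorem coord_rot_pow (m i : ℕ) (X : EuclideanSpace ℝ (Fin (n - 1))) :
    coord m ((rot n ^ i) X) = zeta n ^ ((m + 1) * i) * coord m X := by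
  induction i with
  | zero => simp
  | succ i ih =>
    rw [pow_succ', LinearEquiv.mul_apply, coord_rot, ih, ← mul_assoc, ← pow_add]
    ring_nf

theorem rot_pow_self (hn : n ≠ 0) : rot n ^ n = 1 := by
  refine LinearEquiv.ext fun X => coord_ext fun m _ => ?_
  rw [coord_rot_pow, pow_mul', (zeta_isPrimitiveRoot hn).pow_eq_one, one_pow, one_mul]
  rfl

theorem norm_rot (X : EuclideanSpace ℝ (Fin (n - 1))) : ‖rot n X‖ = ‖X‖ := by
  rw [← sq_eq_sq₀ (norm_nonneg _) (norm_nonneg _), norm_sq_eq_sum_coord, norm_sq_eq_sum_coord]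
  simp only [coord_rot, norm_mul, norm_zeta_pow, one_mul]

theorem norm_rot_zpow (i : ℤ) (X : EuclideanSpace ℝ (Fin (n - 1))) :
    ‖(rot n ^ i) X‖ = ‖X‖ := by
  simpa using apply_zpow_smul_of_semiconj (g := rot n) (h := (1 : ℝˣ)) (f := norm)
    (fun X => by simpa using norm_rot X) i X

theorem mem_rotGroup_iff {g : EuclideanSpace ℝ (Fin (n - 1)) ≃ₗ[ℝ] EuclideanSpace ℝ (Fin (n - 1))} :
    g ∈ rotGroup n ↔ ∃ i : ℤ, g = rot n ^ i ∨ g = LinearEquiv.neg ℝ * rot n ^ i := by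
  have neg_mul_comm (g : EuclideanSpace ℝ (Fin (n - 1)) ≃ₗ[ℝ] _) :
      g * LinearEquiv.neg ℝ = LinearEquiv.neg ℝ * g := LinearEquiv.ext fun X => map_neg g X
  have neg_mul_neg (g : EuclideanSpace ℝ (Fin (n - 1)) ≃ₗ[ℝ] _) :
      LinearEquiv.neg ℝ * (LinearEquiv.neg ℝ * g) = g := LinearEquiv.ext fun X => neg_neg (g X)
  constructor
  · intro hg
    induction hg using Subgroup.closure_induction with
    | mem x hx =>
      rcases hx with rfl | rfl
      · exact ⟨1, Or.inl (zpow_one _).symm⟩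
      · exact ⟨0, Or.inr (by simp)⟩
    | one => exact ⟨0, Or.inl (zpow_zero _).symm⟩
    | mul x y _ _ hx hy =>
      obtain ⟨a, rfl | rfl⟩ := hx <;> obtain ⟨b, rfl | rfl⟩ := hy
      all_goals refine ⟨a + b, ?_⟩
      · exact Or.inl (zpow_add _ _ _).symm
      · rw [← mul_assoc, neg_mul_comm, mul_assoc, ← zpow_add]
        exact Or.inr rfl
      · rw [mul_assoc, ← zpow_add]
        exact Or.inr rfl
      · rw [mul_assoc, ← mul_assoc (rot n ^ a), neg_mul_comm, mul_assoc, neg_mul_neg, ← zpow_add]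
        exact Or.inl rfl
    | inv x _ hx =>
      obtain ⟨a, rfl | rfl⟩ := hx
      · exact ⟨-a, Or.inl (zpow_neg _ _).symm⟩
      · refine ⟨-a, Or.inr ?_⟩
        rw [inv_eq_iff_mul_eq_one, mul_assoc, ← mul_assoc (rot n ^ a), neg_mul_comm, mul_assoc,
          neg_mul_neg, ← zpow_add, add_neg_cancel, zpow_zero]
  · have rot_mem (i : ℤ) : rot n ^ i ∈ rotGroup n := zpow_mem (Subgroup.subset_closure (by simp)) i
    rintro ⟨i, rfl | rfl⟩
    · exact rot_mem i
    · exact mul_mem (Subgroup.subset_closure (by simp)) (rot_mem i)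

theorem mk_rotGroup_eq_mk {S : Set (EuclideanSpace ℝ (Fin (n - 1)))} {X Y : S} :
    OrbitSpace.mk (rotGroup n) X = OrbitSpace.mk (rotGroup n) Y ↔
      ∃ i : ℤ, X = (rot n ^ i) (Y : EuclideanSpace ℝ (Fin (n - 1))) ∨
        X = -(rot n ^ i) (Y : EuclideanSpace ℝ (Fin (n - 1))) := by
  rw [OrbitSpace.mk_eq_mk]
  constructor
  · rintro ⟨g, hg, h⟩
    obtain ⟨i, rfl | rfl⟩ := mem_rotGroup_iff.1 hg
    exacts [⟨i, Or.inl h.symm⟩, ⟨i, Or.inr h.symm⟩]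
  · rintro ⟨i, h | h⟩
    · exact ⟨_, mem_rotGroup_iff.2 ⟨i, Or.inl rfl⟩, h.symm⟩
    · exact ⟨_, mem_rotGroup_iff.2 ⟨i, Or.inr rfl⟩, h.symm⟩

end Rotation

section EigenSphere

variable {j n : ℕ} {ε : ℝ}

/-- The unit vectors `X` of `ℝⁿ⁻¹` with `𝓡ₙʲ X = ε X`. For `ε = 1` and `ε = -1` these are the two
pieces of `ℓʲ(n)`. -/
def eigenSphere (j n : ℕ) (ε : ℝ) : Set (EuclideanSpace ℝ (Fin (n - 1))) :=
  {X | X ∈ Metric.sphere 0 1 ∧ (rot n ^ j) X = ε • X}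

theorem fixedLocus_eq_union : fixedLocus j n = eigenSphere j n 1 ∪ eigenSphere j n (-1) := by
  ext X
  simp only [fixedLocus, eigenSphere, Set.mem_union, Set.mem_ofPred_eq, one_smul, neg_one_smul,
    and_or_left]

theorem isClosed_eigenSphere : IsClosed (eigenSphere j n ε) :=
  Metric.isClosed_sphere.inter <| isClosed_eq
    ((rot n ^ j).toLinearMap.continuous_of_finiteDimensional) (continuous_const_smul ε)

instance : CompactSpace (eigenSphere j n ε) :=
  isCompact_iff_compactSpace.1 <|
    (isCompact_sphere _ _).of_isClosed_subset isClosed_eigenSphere fun _ hX => hX.1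

theorem disjoint_eigenSphere : Disjoint (eigenSphere j n 1) (eigenSphere j n (-1)) := by
  refine Set.disjoint_left.2 fun X h₁ h₂ => ne_zero_of_mem_unit_sphere ⟨X, h₁.1⟩ ?_
  have : IsAddTorsionFree (EuclideanSpace ℝ (Fin (n - 1))) := .of_isTorsionFree ℝ _
  simpa [self_eq_neg] using h₁.2.symm.trans h₂.2

theorem rot_pow_mul_apply {X : EuclideanSpace ℝ (Fin (n - 1))} (hX : (rot n ^ j) X = ε • X)
    (a : ℕ) : (rot n ^ (j * a)) X = ε ^ a • X := by
  induction a with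
  | zero => simp
  | succ a ih =>
    rw [Nat.mul_succ, pow_add, LinearEquiv.mul_apply, hX, map_smul, ih, smul_smul, pow_succ']

theorem isEmpty_eigenSphere_neg_one {k : ℕ} (hn : n ≠ 0) (hnk : n = j * k) (hk : Odd k) :
    IsEmpty (eigenSphere j n (-1)) := by
  refine ⟨fun X => ne_zero_of_mem_unit_sphere ⟨X.1, X.2.1⟩ ?_⟩
  have : IsAddTorsionFree (EuclideanSpace ℝ (Fin (n - 1))) := .of_isTorsionFree ℝ _
  have h := rot_pow_mul_apply X.2.2 k
  rw [← hnk, rot_pow_self hn, hk.neg_one_pow, neg_one_smul] at h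
  exact self_eq_neg.1 h

theorem neg_mem_eigenSphere {X : EuclideanSpace ℝ (Fin (n - 1))} (hX : X ∈ eigenSphere j n ε) :
    -X ∈ eigenSphere j n ε :=
  ⟨by simpa using hX.1, by rw [map_neg, hX.2, smul_neg]⟩

theorem rot_zpow_mem_eigenSphere {X : EuclideanSpace ℝ (Fin (n - 1))}
    (hX : X ∈ eigenSphere j n ε) (i : ℤ) : (rot n ^ i) X ∈ eigenSphere j n ε := by
  refine ⟨by simpa [norm_rot_zpow] using hX.1, ?_⟩
  rw [← LinearEquiv.mul_apply, ((Commute.refl (rot n)).pow_left j).zpow_right i,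
    LinearEquiv.mul_apply, hX.2, map_smul]

theorem smul_mem_eigenSphere {g : EuclideanSpace ℝ (Fin (n - 1)) ≃ₗ[ℝ] _} (hg : g ∈ rotGroup n) :
    ∀ X ∈ eigenSphere j n ε, g • X ∈ eigenSphere j n ε := by
  obtain ⟨i, rfl | rfl⟩ := mem_rotGroup_iff.1 hg
  · exact fun X hX => rot_zpow_mem_eigenSphere hX i
  · exact fun X hX => neg_mem_eigenSphere (rot_zpow_mem_eigenSphere hX i)

/-- The two pieces of `ℓʲ(n)` are disjoint, closed and invariant. -/
noncomputable def fixedLocusHomeomorphSum (j n : ℕ) :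
    OrbitSpace (rotGroup n) (fixedLocus j n) ≃ₜ
      OrbitSpace (rotGroup n) (eigenSphere j n 1) ⊕
        OrbitSpace (rotGroup n) (eigenSphere j n (-1)) :=
  OrbitSpace.homeomorphSum _ fixedLocus_eq_union isClosed_eigenSphere isClosed_eigenSphere
    disjoint_eigenSphere fun _ hg => smul_mem_eigenSphere hg

section LinearMap

variable {F : Type*} [NormedAddCommGroup F] [NormedSpace ℝ F]
  {Φ : EuclideanSpace ℝ (Fin (n - 1)) →ₗ[ℝ] F}

theorem map_eq_map_iff (hnorm : ∀ X, (rot n ^ j) X = ε • X → ‖Φ X‖ = ‖X‖)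
    {X Y : EuclideanSpace ℝ (Fin (n - 1))} (hX : (rot n ^ j) X = ε • X)
    (hY : (rot n ^ j) Y = ε • Y) : Φ X = Φ Y ↔ X = Y := by
  rw [← sub_eq_zero, ← map_sub, ← norm_eq_zero,
    hnorm (X - Y) (by rw [map_sub, hX, hY, smul_sub]), norm_eq_zero, sub_eq_zero]

/-- The homeomorphism of unit spheres given by a linear map that is isometric on the `ε`-eigenspace
of `𝓡ₙʲ` and maps it onto `F`. -/
noncomputable def eigenSphereHomeomorph (hnorm : ∀ X, (rot n ^ j) X = ε • X → ‖Φ X‖ = ‖X‖)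
    (hsurj : ∀ y, ∃ X, (rot n ^ j) X = ε • X ∧ Φ X = y) :
    eigenSphere j n ε ≃ₜ Metric.sphere (0 : F) 1 := by
  let Ψ (X : eigenSphere j n ε) : Metric.sphere (0 : F) 1 :=
    ⟨Φ X, by simpa [hnorm _ X.2.2] using X.2.1⟩
  have Ψ_injective : Function.Injective Ψ := fun X Y h =>
    Subtype.ext ((map_eq_map_iff hnorm X.2.2 Y.2.2).1 (congrArg Subtype.val h))
  have Ψ_surjective : Function.Surjective Ψ := fun y => by
    obtain ⟨X, hX, hy⟩ := hsurj y
    exact ⟨⟨X, by simp [← hnorm X hX, hy], hX⟩, Subtype.ext hy⟩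
  exact Continuous.homeoOfEquivCompactToT2 (f := .ofBijective Ψ ⟨Ψ_injective, Ψ_surjective⟩)
    ((Φ.continuous_of_finiteDimensional.comp continuous_subtype_val).subtype_mk _)

theorem eigenSphereHomeomorph_val (hnorm : ∀ X, (rot n ^ j) X = ε • X → ‖Φ X‖ = ‖X‖)
    (hsurj : ∀ y, ∃ X, (rot n ^ j) X = ε • X ∧ Φ X = y) (X : eigenSphere j n ε) :
    (eigenSphereHomeomorph hnorm hsurj X : F) = Φ X := rfl

end LinearMap

end EigenSphere

section Readout

variable {n : ℕ}

/-- The linear form whose values along an `𝓡ₙ`-orbit are the vertices of a segment. -/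
noncomputable def readout (n : ℕ) : EuclideanSpace ℝ (Fin (n - 1)) →ₗ[ℝ] ℝ :=
  ∑ m ∈ Finset.range (n / 2), Complex.reLm ∘ₗ coord m

theorem two_mul_readout_rot_pow (X : EuclideanSpace ℝ (Fin (n - 1))) (i : ℕ) :
    (2 * readout n ((rot n ^ i) X) : ℂ) = ∑ m ∈ Finset.range (n / 2),
      (coord m X * (zeta n ^ i) ^ (m + 1) +
        starRingEnd ℂ (coord m X) * (zeta n ^ i) ^ (n - (m + 1))) := by
  simp only [readout, LinearMap.sum_apply, LinearMap.comp_apply, Complex.reLm_coe,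
    Complex.ofReal_sum, Finset.mul_sum, coord_rot_pow]
  refine Finset.sum_congr rfl fun m hm => ?_
  have hmn : m < n / 2 := Finset.mem_range.1 hm
  have conj_zeta_pow : starRingEnd ℂ (zeta n ^ ((m + 1) * i)) =
      (zeta n ^ i) ^ (n - (m + 1)) := by
    rw [← Complex.inv_eq_conj (norm_zeta_pow _)]
    refine inv_eq_of_mul_eq_one_right ?_
    rw [pow_mul', ← pow_add, Nat.add_sub_cancel' (by omega), ← pow_mul', pow_mul,
      (zeta_isPrimitiveRoot (by omega)).pow_eq_one, one_pow]
  rw [Complex.re_eq_add_conj, map_mul, conj_zeta_pow, pow_mul']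
  ring

-- The values of the readout are those of a polynomial of degree `< n` at the `n`-th roots of unity.
theorem eq_zero_of_readout_rot_pow_eq_const {X : EuclideanSpace ℝ (Fin (n - 1))} {b : ℝ}
    (h : ∀ i < n, readout n ((rot n ^ i) X) = b) : X = 0 := by
  refine coord_ext fun l hl => ?_
  let P : Polynomial ℂ := Polynomial.C (-(2 * b : ℂ)) + ∑ m ∈ Finset.range (n / 2),
    (Polynomial.monomial (m + 1) (coord m X) +
      Polynomial.monomial (n - (m + 1)) (starRingEnd ℂ (coord m X)))
  have degree_lt : P.degree < n := by
    rw [← Polynomial.mem_degreeLT]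
    refine add_mem ?_ (sum_mem fun m hm => ?_)
    · exact Polynomial.mem_degreeLT.2 (Polynomial.degree_C_le.trans_lt (by norm_cast; omega))
    · have := Finset.mem_range.1 hm
      refine add_mem ?_ ?_ <;> refine Polynomial.mem_degreeLT.2
        ((Polynomial.degree_monomial_le _ _).trans_lt (by norm_cast; omega))
  have eval_eq_zero (i : ℕ) (hi : i < n) : P.eval (zeta n ^ i) = 0 := by
    have := two_mul_readout_rot_pow X i
    rw [h i hi] at this
    simp [P, Polynomial.eval_finsetSum, ← this]
  have P_eq_zero : P = 0 :=
    Polynomial.eq_zero_of_degree_lt_of_eval_index_eq_zero (Finset.range n)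
      (fun i hi i' hi' => (zeta_isPrimitiveRoot (by omega)).pow_inj
        (Finset.mem_range.1 hi) (Finset.mem_range.1 hi'))
      (by simpa using degree_lt) fun i hi => eval_eq_zero i (Finset.mem_range.1 hi)
  have coeff_eq : P.coeff (l + 1) =
      coord l X + if 2 * l + 2 = n then starRingEnd ℂ (coord l X) else 0 := by
    simp only [P, Polynomial.coeff_add, Polynomial.finsetSum_coeff, Polynomial.coeff_C_succ,
      Polynomial.coeff_monomial, zero_add]
    rw [Finset.sum_eq_single_of_mem l (Finset.mem_range.2 hl) fun m hm hml => ?_]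
    · rw [if_pos rfl, if_congr (show n - (l + 1) = l + 1 ↔ 2 * l + 2 = n by omega) rfl rfl]
    · have := Finset.mem_range.1 hm
      rw [if_neg (by omega), if_neg (by omega), add_zero]
  rw [P_eq_zero, Polynomial.coeff_zero] at coeff_eq
  split_ifs at coeff_eq with hlast
  · simpa [Complex.conj_eq_iff_im.2 (coord_im_of_last hlast X)] using coeff_eq.symm
  · simpa using coeff_eq.symm

theorem exists_readout_rot_pow_add_eq (hn : n ≠ 0) (w : Fin n → ℝ) :
    ∃ (X : EuclideanSpace ℝ (Fin (n - 1))) (b : ℝ),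
      ∀ i : Fin n, readout n ((rot n ^ i.1) X) + b = w i := by
  let T : EuclideanSpace ℝ (Fin (n - 1)) × ℝ →ₗ[ℝ] (Fin n → ℝ) :=
    LinearMap.pi fun i => (readout n ∘ₗ (rot n ^ i.1).toLinearMap).coprod LinearMap.id
  have T_injective : Function.Injective T := by
    refine (injective_iff_map_eq_zero T).2 fun ⟨X, b⟩ h => ?_
    have hb (i : ℕ) (hi : i < n) : readout n ((rot n ^ i) X) = -b :=
      eq_neg_of_add_eq_zero_left (congrFun h ⟨i, hi⟩)
    obtain rfl := eq_zero_of_readout_rot_pow_eq_const hb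
    simpa using hb 0 (by omega)
  obtain ⟨⟨X, b⟩, h⟩ := (LinearMap.injective_iff_surjective_of_finrank_eq_finrank
    (by simp; omega)).1 T_injective w
  exact ⟨X, b, congrFun h⟩

variable {j : ℕ}

theorem rot_pow_mod_apply {X : EuclideanSpace ℝ (Fin (n - 1))} (hX : (rot n ^ j) X = X) (i : ℕ) :
    (rot n ^ (i % j)) X = (rot n ^ i) X := by
  have h := rot_pow_mul_apply (ε := 1) (by rwa [one_smul]) (i / j)
  conv_rhs => rw [← Nat.mod_add_div i j, pow_add, LinearEquiv.mul_apply, h, one_pow, one_smul]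

theorem eq_zero_of_fixed_of_readout_eq_const (hj : j ≠ 0) {X : EuclideanSpace ℝ (Fin (n - 1))}
    (hX : (rot n ^ j) X = X) {b : ℝ} (h : ∀ i : Fin j, readout n ((rot n ^ i.1) X) = b) :
    X = 0 :=
  eq_zero_of_readout_rot_pow_eq_const fun i _ => by
    rw [← rot_pow_mod_apply hX]
    exact h ⟨i % j, Nat.mod_lt _ (Nat.pos_of_ne_zero hj)⟩

theorem exists_fixed_readout_add_eq (hn : n ≠ 0) (hjn : j ∣ n) (w : Fin j → ℝ) :
    ∃ (X : EuclideanSpace ℝ (Fin (n - 1))) (b : ℝ), (rot n ^ j) X = X ∧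
      ∀ i : Fin j, readout n ((rot n ^ i.1) X) + b = w i := by
  have hj : 0 < j := Nat.pos_of_ne_zero (by rintro rfl; exact hn (zero_dvd_iff.1 hjn))
  obtain ⟨X, b, h⟩ := exists_readout_rot_pow_add_eq hn fun i : Fin n => w ⟨i.1 % j, Nat.mod_lt _ hj⟩
  have readout_add_eq (i : ℕ) :
      readout n ((rot n ^ i) X) + b = w ⟨i % j, Nat.mod_lt _ hj⟩ := by
    rw [← rot_pow_mod_apply (j := n) (by rw [rot_pow_self hn]; rfl) i,
      h ⟨i % n, Nat.mod_lt _ (Nat.pos_of_ne_zero hn)⟩]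
    simp only [Nat.mod_mod_of_dvd i hjn]
  refine ⟨X, b, ?_, fun i => ?_⟩
  · rw [← sub_eq_zero]
    refine eq_zero_of_readout_rot_pow_eq_const (b := 0) fun i _ => ?_
    rw [map_sub, ← LinearEquiv.mul_apply, ← pow_add, map_sub, sub_eq_zero,
      ← add_left_inj b, readout_add_eq, readout_add_eq]
    simp only [Nat.add_mod_right]
  · simp only [readout_add_eq, Nat.mod_eq_of_lt i.2]

end Readout

section Shapes

theorem Polygon.exists_ne {n : ℕ} (Z : Polygon n) : ∃ c d, Z.1 c ≠ Z.1 d := by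
  by_contra! h
  rcases isEmpty_or_nonempty (Fin n) with hn | ⟨⟨i⟩⟩
  exacts [Z.2 ⟨0, isEmptyElim⟩, Z.2 ⟨Z.1 i, fun k => h k i⟩]

theorem affineSetoid_iff {n : ℕ} {Z W : Polygon n} :
    affineSetoid n Z W ↔ ∀ a b c d,
      (W.1 a - W.1 b) * (Z.1 c - Z.1 d) = (W.1 c - W.1 d) * (Z.1 a - Z.1 b) := by
  constructor
  · rintro ⟨r, s, -, h⟩ a b c d
    simp only [h]
    ring
  · intro h
    obtain ⟨c, d, hcd⟩ := Z.exists_ne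
    have hcd' : Z.1 c - Z.1 d ≠ 0 := sub_ne_zero.2 hcd
    have sub_eq (a b : Fin n) :
        W.1 a - W.1 b = (W.1 c - W.1 d) / (Z.1 c - Z.1 d) * (Z.1 a - Z.1 b) := by
      rw [div_mul_eq_mul_div, ← h a b c d, mul_div_cancel_right₀ _ hcd']
    refine ⟨(W.1 c - W.1 d) / (Z.1 c - Z.1 d),
      W.1 d - (W.1 c - W.1 d) / (Z.1 c - Z.1 d) * Z.1 d, fun h0 => ?_, fun i => ?_⟩
    · obtain ⟨a, b, hab⟩ := W.exists_ne
      exact hab (sub_eq_zero.1 (by rw [sub_eq, h0, zero_mul]))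
    · linear_combination sub_eq i d

theorem shape_eq_shape_iff {n : ℕ} {Z W : Polygon n} :
    shape n Z = shape n W ↔ affineSetoid n Z W :=
  Quotient.eq

theorem continuous_vertex {n : ℕ} (i : Fin n) : Continuous fun Z : Polygon n => Z.1 i :=
  (continuous_apply i).comp continuous_subtype_val

theorem isOpenQuotientMap_shape (n : ℕ) : IsOpenQuotientMap (shape n) := by
  refine isOpenQuotientMap_quotientMk fun Z W ⟨a, b, ha, h⟩ =>
    ⟨fun V => ⟨fun i => a * V.1 i + b, fun ⟨c, hc⟩ => V.2 ⟨(c - b) / a, fun i => ?_⟩⟩, ?_,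
      Subtype.ext (funext fun i => (h i).symm), fun V => ⟨a, b, ha, fun _ => rfl⟩⟩
  · rw [eq_div_iff ha, ← hc i]
    ring
  · exact (continuous_pi fun i =>
      ((continuous_vertex i).const_mul a).add continuous_const).subtype_mk _

instance (n : ℕ) : T2Space (ShapeSpace n) := by
  refine (t2Space_iff_of_isOpenQuotientMap (isOpenQuotientMap_shape n)).2 ?_
  have : {p : Polygon n × Polygon n | shape n p.1 = shape n p.2} =
      ⋂ (a) (b) (c) (d), {p | (p.2.1 a - p.2.1 b) * (p.1.1 c - p.1.1 d) =
        (p.2.1 c - p.2.1 d) * (p.1.1 a - p.1.1 b)} := by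
    ext p
    simpa using shape_eq_shape_iff.trans affineSetoid_iff
  rw [this]
  have continuous_sub (a b : Fin n) : Continuous fun Z : Polygon n => Z.1 a - Z.1 b :=
    (continuous_vertex a).sub (continuous_vertex b)
  exact isClosed_iInter fun a => isClosed_iInter fun b => isClosed_iInter fun c =>
    isClosed_iInter fun d => isClosed_eq
      (((continuous_sub a b).comp continuous_snd).mul ((continuous_sub c d).comp continuous_fst))
      (((continuous_sub c d).comp continuous_snd).mul ((continuous_sub a b).comp continuous_fst))

end Shapes

section FixedVectors

variable {j n : ℕ}

/-- The permutation of the eigensphere given by `𝓡ₙ`. -/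
noncomputable def eigenSphereRot (j n : ℕ) (ε : ℝ) : Equiv.Perm (eigenSphere j n ε) :=
  Equiv.Perm.subtypePerm (rot n).toEquiv fun X =>
    ⟨fun h => by simpa using rot_zpow_mem_eigenSphere h (-1),
      fun h => by simpa using rot_zpow_mem_eigenSphere h 1⟩

theorem eigenSphereRot_zpow_val {ε : ℝ} (i : ℤ) (X : eigenSphere j n ε) :
    ((eigenSphereRot j n ε ^ i) X : EuclideanSpace ℝ (Fin (n - 1))) = (rot n ^ i) X.1 :=
  apply_zpow_smul_of_semiconj (g := eigenSphereRot j n ε) (h := rot n) (f := Subtype.val)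
    (fun _ => rfl) i X

theorem eigenSphere_one_apply (X : eigenSphere j n 1) : (rot n ^ j) X.1 = X :=
  X.2.2.trans (one_smul ℝ _)

/-- The segment whose vertices are read off along the `𝓡ₙ`-orbit of a vector fixed by `𝓡ₙʲ`. -/
noncomputable def readoutPolygon (hj : j ≠ 0) (X : eigenSphere j n 1) : Polygon j :=
  ⟨fun i => (readout n ((rot n ^ i.1) X.1) : ℂ), fun ⟨b, hb⟩ =>
    ne_zero_of_mem_unit_sphere ⟨X.1, X.2.1⟩ <|
      eq_zero_of_fixed_of_readout_eq_const hj (eigenSphere_one_apply X) (b := b.re) fun i => by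
        rw [← hb i, Complex.ofReal_re]⟩

theorem readoutPolygon_apply (hj : j ≠ 0) (X : eigenSphere j n 1) (i : Fin j) :
    (readoutPolygon hj X).1 i = (readout n ((rot n ^ i.1) X.1) : ℂ) := rfl

theorem readoutPolygon_mem_segments (hj : j ≠ 0) (X : eigenSphere j n 1) :
    readoutPolygon hj X ∈ segments j := by
  refine (collinear_iff_exists_forall_eq_smul_vadd _).2 ⟨0, 1, ?_⟩
  rintro _ ⟨i, rfl⟩
  exact ⟨readout n ((rot n ^ i.1) X.1), by simp [readoutPolygon_apply]⟩

/-- The shape of the segment read off from a unit vector fixed by `𝓡ₙʲ`. -/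
noncomputable def readoutShape (hj : j ≠ 0) (X : eigenSphere j n 1) : shape j '' segments j :=
  ⟨shape j (readoutPolygon hj X), _, readoutPolygon_mem_segments hj X, rfl⟩

theorem continuous_readoutShape (hj : j ≠ 0) :
    Continuous (readoutShape hj : eigenSphere j n 1 → _) := by
  have continuous_readout_rot_pow (i : ℕ) :
      Continuous fun X : eigenSphere j n 1 => readout n ((rot n ^ i) X.1) :=
    (readout n ∘ₗ (rot n ^ i).toLinearMap).continuous_of_finiteDimensional.comp
      continuous_subtype_val
  have continuous_readoutPolygon : Continuous (readoutPolygon hj : eigenSphere j n 1 → _) :=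
    (continuous_pi fun i : Fin j => Complex.continuous_ofReal.comp
      (continuous_readout_rot_pow i.1)).subtype_mk _
  exact ((isOpenQuotientMap_shape j).continuous.comp continuous_readoutPolygon).subtype_mk _

theorem readoutShape_surjective (hn : n ≠ 0) (hj : j ≠ 0) (hjn : j ∣ n) :
    Function.Surjective (readoutShape hj : eigenSphere j n 1 → _) := by
  rintro ⟨_, Z, hZ, rfl⟩
  obtain ⟨p, v, h⟩ := (collinear_iff_exists_forall_eq_smul_vadd _).1 hZ
  choose w hw using fun i => h _ (Set.mem_range_self i)
  obtain ⟨X, b, hX, hr⟩ := exists_fixed_readout_add_eq hn hjn w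
  simp only [vadd_eq_add, Complex.real_smul, ← hr] at hw
  have hX0 : X ≠ 0 := by
    rintro rfl
    exact Z.2 ⟨b * v + p, fun i => by simp [hw]⟩
  have hv : v ≠ 0 := by
    rintro rfl
    exact Z.2 ⟨p, fun i => by simp [hw]⟩
  have hN : (‖X‖ : ℂ) ≠ 0 := Complex.ofReal_ne_zero.2 (norm_ne_zero_iff.2 hX0)
  refine ⟨⟨‖X‖⁻¹ • X, by simp [norm_smul, hX0], by simp [hX]⟩, Subtype.ext (shape_eq_shape_iff.2
    ⟨‖X‖ * v, b * v + p, mul_ne_zero hN hv, fun i => ?_⟩)⟩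
  simp only [hw, readoutPolygon_apply, map_smul, smul_eq_mul]
  push_cast
  field_simp
  ring

theorem readoutShape_eq_iff (hj : j ≠ 0) {X Y : eigenSphere j n 1} :
    readoutShape hj X = readoutShape hj Y ↔
      (X : EuclideanSpace ℝ (Fin (n - 1))) = Y ∨ (X : EuclideanSpace ℝ (Fin (n - 1))) = -Y := by
  refine (Subtype.ext_iff.trans shape_eq_shape_iff).trans ⟨?_, ?_⟩
  · rintro ⟨a, b, -, h⟩
    have hYX : Y.1 = a.re • X.1 := by
      refine sub_eq_zero.1 (eq_zero_of_fixed_of_readout_eq_const hj (b := b.re) ?_ fun i => ?_)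
      · simp only [map_sub, map_smul, eigenSphere_one_apply]
      · have := congrArg Complex.re (h i)
        simp only [readoutPolygon_apply, Complex.add_re, Complex.re_mul_ofReal,
          Complex.ofReal_re] at this
        simp [this]
    have abs_re : |a.re| = 1 := by
      simpa [norm_smul, mem_sphere_zero_iff_norm.1 X.2.1, mem_sphere_zero_iff_norm.1 Y.2.1]
        using (congrArg norm hYX).symm
    rcases (abs_eq zero_le_one).1 abs_re with ha | ha
    · exact Or.inl (by rw [hYX, ha, one_smul])
    · exact Or.inr (by rw [hYX, ha, neg_one_smul, neg_neg])
  · rintro (h | h)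
    · exact ⟨1, 0, one_ne_zero, fun i => by simp [readoutPolygon_apply, h]⟩
    · exact ⟨-1, 0, by simp, fun i => by simp [readoutPolygon_apply, h]⟩

theorem readoutShape_eigenSphereRot (hj : j ≠ 0) (X : eigenSphere j n 1) :
    (readoutShape hj (eigenSphereRot j n 1 X)).1 = shapeRelabel j (readoutShape hj X).1 := by
  refine congrArg (shape j) (Subtype.ext (funext fun i => ?_))
  have val_finRotate : (finRotate j i).1 = (i.1 + 1) % j := by
    obtain ⟨j, rfl⟩ := Nat.exists_eq_succ_of_ne_zero hj
    simp [finRotate_apply, Fin.val_add]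
  change (readoutPolygon hj (eigenSphereRot j n 1 X)).1 i =
    (readoutPolygon hj X).1 (finRotate j i)
  rw [readoutPolygon_apply, readoutPolygon_apply, val_finRotate,
    rot_pow_mod_apply (eigenSphere_one_apply X), pow_succ, LinearEquiv.mul_apply]
  rfl

/-- The space of unlabelled segments is the quotient of the sphere of vectors fixed by `𝓡ₙʲ`:
`𝓡ₙ` acts as the relabelling, and `X` and `-X` have the same shape. -/
noncomputable def fixedHomeomorphUnlabelledShapes (hn : n ≠ 0) (hj : j ≠ 0) (hjn : j ∣ n) :
    OrbitSpace (rotGroup n) (eigenSphere j n 1) ≃ₜ UnlabelledShapes j :=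
  have hq : IsQuotientMap (readoutShape hj : eigenSphere j n 1 → _) :=
    .of_surjective_continuous (readoutShape_surjective hn hj hjn) (continuous_readoutShape hj)
  quotientHomeomorph (OrbitSpace.isQuotientMap_mk _ _)
    ((OrbitSpace.isQuotientMap_mk (Subgroup.zpowers (shapeRelabel j)) _).comp hq) fun X Y => by
      have readoutShape_zpow (i : ℤ) : shapeRelabel j ^ i • (readoutShape hj Y).1 =
          (readoutShape hj ((eigenSphereRot j n 1 ^ i) Y)).1 :=
        (apply_zpow_smul_of_semiconj (g := eigenSphereRot j n 1)
          (f := fun X => (readoutShape hj X).1)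
          (readoutShape_eigenSphereRot hj) i Y).symm
      rw [mk_rotGroup_eq_mk]
      simp only [Function.comp_apply, OrbitSpace.mk_eq_mk,
        Subgroup.exists_mem_zpowers, readoutShape_zpow, ← Subtype.ext_iff, readoutShape_eq_iff,
        eigenSphereRot_zpow_val]
      exact exists_congr fun i => or_congr eq_comm (by rw [eq_comm, neg_eq_iff_eq_neg])

end FixedVectors

section AntiBlocks

variable {n c j : ℕ}

theorem zeta_pow_mul_eq_neg_one_iff (hc : c ≠ 0) (hj : j ≠ 0) {m : ℕ} :
    zeta (2 * (c * j)) ^ (m * j) = -1 ↔ ∃ t, m = c * (2 * t + 1) := by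
  have hζ := zeta_isPrimitiveRoot (n := 2 * (c * j)) (by positivity)
  have pow_block (s : ℕ) : zeta (2 * (c * j)) ^ (c * s * j) = (-1) ^ s := by
    rw [mul_right_comm, pow_mul, zeta_two_mul_pow (mul_ne_zero hc hj)]
  constructor
  · intro h
    have dvd : 2 * (c * j) ∣ 2 * (m * j) := by
      rw [← hζ.pow_eq_one_iff_dvd, mul_comm 2 (m * j), pow_mul, h, neg_one_sq]
    obtain ⟨s, rfl⟩ := Nat.dvd_of_mul_dvd_mul_right (Nat.pos_of_ne_zero hj)
      (Nat.dvd_of_mul_dvd_mul_left two_pos dvd)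
    rw [pow_block, neg_one_pow_eq_neg_one_iff_odd (by norm_num)] at h
    obtain ⟨t, rfl⟩ := h
    exact ⟨t, rfl⟩
  · rintro ⟨t, rfl⟩
    rw [pow_block, Odd.neg_one_pow (odd_two_mul_add_one t)]

/-- The index (counted from `0`) of the block of `𝓡ₙ` with angle `c (2t + 1) · 2π/n`. For
`n = 2cj` these are the blocks where `𝓡ₙʲ` is `-1`. -/
def antiBlock (c t : ℕ) : ℕ := c * (2 * t + 1) - 1

theorem antiBlock_add_one (hc : c ≠ 0) (t : ℕ) : antiBlock c t + 1 = c * (2 * t + 1) :=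
  Nat.sub_add_cancel (Nat.one_le_iff_ne_zero.2 (by positivity))

theorem eq_antiBlock_iff (hc : c ≠ 0) {m t : ℕ} : m = antiBlock c t ↔ m + 1 = c * (2 * t + 1) := by
  rw [← antiBlock_add_one hc, add_left_inj]

theorem antiBlock_injective (hc : c ≠ 0) : Function.Injective (antiBlock c) := fun t t' h => by
  rw [eq_antiBlock_iff hc, antiBlock_add_one hc, mul_right_inj' hc] at h
  omega

theorem antiBlock_lt_iff (hc : c ≠ 0) {t : ℕ} : antiBlock c t < c * j ↔ t < (j + 1) / 2 := by
  rw [← Nat.succ_le_iff, Nat.succ_eq_add_one, antiBlock_add_one hc,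
    mul_le_mul_iff_right₀ (Nat.pos_of_ne_zero hc)]
  omega

theorem rot_pow_eq_neg_iff (hc : c ≠ 0) (hj : j ≠ 0) (hn : n = 2 * (c * j))
    {X : EuclideanSpace ℝ (Fin (n - 1))} :
    (rot n ^ j) X = (-1 : ℝ) • X ↔
      ∀ m < n / 2, coord m X ≠ 0 → ∃ t, m = antiBlock c t := by
  have coord_iff (m : ℕ) : coord m ((rot n ^ j) X) = coord m ((-1 : ℝ) • X) ↔
      (coord m X ≠ 0 → ∃ t, m = antiBlock c t) := by
    simp only [eq_antiBlock_iff hc, ← zeta_pow_mul_eq_neg_one_iff hc hj, ← hn]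
    rw [coord_rot_pow, map_smul, neg_one_smul, ← neg_one_mul, mul_eq_mul_right_iff, or_comm,
      or_iff_not_imp_left]
  simp only [← coord_iff]
  exact ⟨fun h m _ => by rw [h], coord_ext⟩

theorem norm_sq_eq_sum_antiBlock (hc : c ≠ 0) (hj : j ≠ 0) (hn : n = 2 * (c * j))
    {X : EuclideanSpace ℝ (Fin (n - 1))} (hX : (rot n ^ j) X = (-1 : ℝ) • X) :
    ‖X‖ ^ 2 = ∑ t ∈ Finset.range ((j + 1) / 2), ‖coord (antiBlock c t) X‖ ^ 2 := by
  have half : n / 2 = c * j := by omega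
  rw [norm_sq_eq_sum_coord, half]
  refine (Finset.sum_of_injOn _ (antiBlock_injective hc).injOn (fun t ht => ?_) (fun m hm hmt => ?_)
    fun _ _ => rfl).symm
  · simpa [antiBlock_lt_iff hc] using ht
  · by_contra h0
    have hm' : m < c * j := Finset.mem_range.1 hm
    obtain ⟨t, rfl⟩ := (rot_pow_eq_neg_iff hc hj hn).1 hX m (by omega) fun h => h0 (by simp [h])
    exact hmt ⟨t, by simpa using (antiBlock_lt_iff hc).1 hm', rfl⟩

theorem exists_coord_antiBlock_eq (hc : c ≠ 0) (hj : j ≠ 0) (hn : n = 2 * (c * j)) {e : ℕ → ℂ}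
    (he : ∀ t, 2 * t + 1 = j → (e t).im = 0) :
    ∃ X : EuclideanSpace ℝ (Fin (n - 1)), (rot n ^ j) X = (-1 : ℝ) • X ∧
      ∀ t < (j + 1) / 2, coord (antiBlock c t) X = e t := by
  let d : ℕ → ℂ := Function.extend (antiBlock c) e (0 : ℕ → ℂ)
  have d_antiBlock (t : ℕ) : d (antiBlock c t) = e t :=
    (antiBlock_injective hc).extend_apply e 0 t
  have d_eq_zero (m : ℕ) (hm : ¬ ∃ t, antiBlock c t = m) : d m = 0 :=
    Function.extend_apply' (f := antiBlock c) e (0 : ℕ → ℂ) m hm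
  have coord_eq (m : ℕ) (hm : m < n / 2) : coord m (ofCoord n d) = d m := by
    refine coord_ofCoord hm fun hlast => ?_
    by_cases h : ∃ t, antiBlock c t = m
    · obtain ⟨t, rfl⟩ := h
      rw [d_antiBlock, he t]
      refine Nat.eq_of_mul_eq_mul_left (Nat.pos_of_ne_zero hc) ?_
      rw [← antiBlock_add_one hc]
      omega
    · rw [d_eq_zero m h, Complex.zero_im]
  refine ⟨ofCoord n d, (rot_pow_eq_neg_iff hc hj hn).2 fun m hm h0 => ?_, fun t ht => ?_⟩
  · by_contra h
    exact h0 (by rw [coord_eq m hm, d_eq_zero m fun ⟨t, ht⟩ => h ⟨t, ht.symm⟩])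
  · rw [coord_eq _ (((antiBlock_lt_iff hc).2 ht).trans_eq (by omega)), d_antiBlock]

/-- The complex coordinates in the first `m` blocks where `𝓡ₙʲ` is `-1`. -/
noncomputable def lensCoords {N : ℕ} (c m : ℕ) :
    EuclideanSpace ℝ (Fin N) →ₗ[ℝ] EuclideanSpace ℂ (Fin m) :=
  (WithLp.linearEquiv 2 ℝ (Fin m → ℂ)).symm.toLinearMap ∘ₗ
    LinearMap.pi fun t : Fin m => coord (antiBlock c t)

theorem lensCoords_apply {N m : ℕ} (X : EuclideanSpace ℝ (Fin N)) (t : Fin m) :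
    lensCoords c m X t = coord (antiBlock c t) X := rfl

theorem norm_sq_lensCoords {N m : ℕ} (X : EuclideanSpace ℝ (Fin N)) :
    ‖lensCoords c m X‖ ^ 2 = ∑ t ∈ Finset.range m, ‖coord (antiBlock c t) X‖ ^ 2 := by
  rw [EuclideanSpace.norm_sq_eq]
  exact Fin.sum_univ_eq_sum_range (fun t => ‖coord (antiBlock c t) X‖ ^ 2) m

theorem lensCoords_rot_pow {m q s : ℕ} (hc : c ≠ 0) (hs : s ≠ 0) (hn : n = c * s * q)
    (X : EuclideanSpace ℝ (Fin (n - 1))) :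
    lensCoords c m ((rot n ^ s) X) = lensMap q (oddWeights m) (lensCoords c m X) := by
  ext t
  rw [lensCoords_apply, coord_rot_pow, antiBlock_add_one hc, zeta_pow_eq_exp]
  change _ = Complex.exp (2 * Real.pi * Complex.I * ((oddWeights m t : ℤ) / q)) *
    coord (antiBlock c t) X
  have hcs : ((c : ℂ) * s) ≠ 0 := by positivity
  congr 2
  rw [hn, oddWeights]
  push_cast
  rw [← mul_div_mul_left _ (q : ℂ) hcs]
  ring

end AntiBlocks

section NegatedVectors

variable {n c j m : ℕ}

theorem rot_zpow_natCast_add_apply (X : eigenSphere j n (-1)) (i : ℤ) :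
    (rot n ^ (i + j)) X.1 = -(rot n ^ i) X.1 := by
  rw [zpow_add, zpow_natCast, LinearEquiv.mul_apply, X.2.2, neg_one_smul, map_neg]

theorem mk_eq_mk_iff_exists_zpow {X Y : eigenSphere j n (-1)} :
    OrbitSpace.mk (rotGroup n) X = OrbitSpace.mk (rotGroup n) Y ↔
      ∃ i : ℤ, X.1 = (rot n ^ i) Y.1 := by
  rw [mk_rotGroup_eq_mk]
  refine ⟨fun ⟨i, h⟩ => h.elim (⟨i, ·⟩) fun h => ⟨i + j, ?_⟩, fun ⟨i, h⟩ => ⟨i, Or.inl h⟩⟩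
  rw [rot_zpow_natCast_add_apply, h]

theorem mk_eq_mk_iff_exists_sq_zpow (hj : Odd j) {X Y : eigenSphere j n (-1)} :
    OrbitSpace.mk (rotGroup n) X = OrbitSpace.mk (rotGroup n) Y ↔
      ∃ i : ℤ, X.1 = (rot n ^ (2 * i)) Y.1 ∨ X.1 = -(rot n ^ (2 * i)) Y.1 := by
  rw [mk_eq_mk_iff_exists_zpow]
  constructor
  · rintro ⟨i, h⟩
    rcases i.even_or_odd' with ⟨a, rfl | rfl⟩
    · exact ⟨a, Or.inl h⟩
    · obtain ⟨b, hb⟩ := (odd_two_mul_add_one a).add_odd ((Int.odd_coe_nat j).2 hj)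
      refine ⟨b, Or.inr ?_⟩
      rw [two_mul, ← hb, rot_zpow_natCast_add_apply, neg_neg, h]
  · rintro ⟨i, h | h⟩
    · exact ⟨_, h⟩
    · exact ⟨2 * i + j, by rw [rot_zpow_natCast_add_apply, h]⟩

/-- The negated vectors for `j = 2m`: `𝓡ₙ` acts on their complex coordinates as the lens map of
order `2j`. -/
noncomputable def negatedHomeomorphLensSpace (hc : c ≠ 0) (hm : m ≠ 0)
    (hn : n = 2 * (c * (2 * m))) :
    OrbitSpace (rotGroup n) (eigenSphere (2 * m) n (-1)) ≃ₜ
      LensSpace (2 * (2 * m)) (oddWeights m) :=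
  have hm' : 2 * m ≠ 0 := by positivity
  have hm₂ : (2 * m + 1) / 2 = m := by omega
  have norm_eq (X) (hX : (rot n ^ (2 * m)) X = (-1 : ℝ) • X) : ‖lensCoords c m X‖ = ‖X‖ := by
    rw [← sq_eq_sq₀ (norm_nonneg _) (norm_nonneg _), norm_sq_lensCoords,
      norm_sq_eq_sum_antiBlock hc hm' hn hX, hm₂]
  have exists_eq (z : EuclideanSpace ℂ (Fin m)) :
      ∃ X, (rot n ^ (2 * m)) X = (-1 : ℝ) • X ∧ lensCoords c m X = z := by
    obtain ⟨X, hX, h⟩ := exists_coord_antiBlock_eq hc hm' hn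
      (e := fun t => if h : t < m then z ⟨t, h⟩ else 0) fun t ht => by omega
    refine ⟨X, hX, PiLp.ext fun t => ?_⟩
    rw [lensCoords_apply, h t (by omega), dif_pos t.2]
  quotientHomeomorph (OrbitSpace.isQuotientMap_mk _ _)
    ((OrbitSpace.isQuotientMap_mk (Subgroup.zpowers (lensMap (2 * (2 * m)) (oddWeights m))) _).comp
      (eigenSphereHomeomorph norm_eq exists_eq).isQuotientMap) fun X Y => by
    have lensMap_zpow (i : ℤ) : lensMap (2 * (2 * m)) (oddWeights m) ^ i • lensCoords c m Y.1 =
        lensCoords c m ((rot n ^ i) Y.1) :=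
      (apply_zpow_smul_of_semiconj (g := rot n) (f := lensCoords c m) (fun X => by
        simpa using lensCoords_rot_pow hc one_ne_zero (hn.trans (by ring)) X) i Y.1).symm
    rw [mk_eq_mk_iff_exists_zpow, Function.comp_apply, Function.comp_apply, OrbitSpace.mk_eq_mk]
    simp only [Subgroup.exists_mem_zpowers, eigenSphereHomeomorph_val, lensMap_zpow]
    refine exists_congr fun i => ?_
    rw [map_eq_map_iff norm_eq (rot_zpow_mem_eigenSphere Y.2 i).2 X.2.2, eq_comm]

end NegatedVectors

section ConeOverQuotient

variable {X A Q : Type*} [TopologicalSpace A] (q : X → A) (τ : A → A)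

/-- The projection onto `ConeModBase τ` from the cylinder over a space `X` that maps to `A`,
together with a point over the apex. -/
def coneProj : (X × unitInterval) ⊕ Unit → ConeModBase τ :=
  Quot.mk _ ∘ Quot.mk _ ∘ Sum.map (Prod.map q id) id

theorem coneProj_one (x : X) : coneProj q τ (.inl (x, 1)) = coneProj q τ (.inr ()) :=
  congrArg (Quot.mk _) (Quot.sound (.apex (q x)))

variable {q τ}

theorem coneProj_congr {x y : X} (h : q x = q y) (s : unitInterval) :
    coneProj q τ (.inl (x, s)) = coneProj q τ (.inl (y, s)) :=
  congrArg (fun a => Quot.mk _ (Cone.mk a s)) h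

theorem coneProj_zero {σ : X → X} (hτ : ∀ x, τ (q x) = q (σ x)) (x : X) :
    coneProj q τ (.inl (x, 0)) = coneProj q τ (.inl (σ x, 0)) :=
  (Quot.sound (.base (q x))).trans (congrArg (fun a => Quot.mk _ (Cone.mk a 0)) (hτ x))

theorem isQuotientMap_coneProj [TopologicalSpace X] (hq : IsOpenQuotientMap q) :
    IsQuotientMap (coneProj q τ) :=
  (isQuotientMap_quot_mk.comp isQuotientMap_quot_mk).comp
    (isQuotientMap_sumMap (hq.prodMap .id).isQuotientMap .id)

theorem eq_of_coneProj_eq {σ : X → X} (hq : Function.Surjective q) (hτ : ∀ x, τ (q x) = q (σ x))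
    {F : (X × unitInterval) ⊕ Unit → Q}
    (hcongr : ∀ x y s, q x = q y → F (.inl (x, s)) = F (.inl (y, s)))
    (hone : ∀ x, F (.inl (x, 1)) = F (.inr ()))
    (hzero : ∀ x, F (.inl (x, 0)) = F (.inl (σ x, 0)))
    {a b : (X × unitInterval) ⊕ Unit} (h : coneProj q τ a = coneProj q τ b) : F a = F b := by
  let r : A → X := Function.surjInv hq
  have q_r (a : A) : q (r a) = a := Function.surjInv_eq hq a
  let cylinderLift : (A × unitInterval) ⊕ Unit → Q := F ∘ Sum.map (Prod.map r id) id
  let coneLift : Cone A → Q := Quot.lift cylinderLift fun _ _ ⟨a⟩ => hone (r a)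
  let lift : ConeModBase τ → Q := Quot.lift coneLift fun _ _ ⟨a⟩ =>
    (hzero (r a)).trans (hcongr _ _ 0 (by rw [← hτ, q_r, q_r]))
  have lift_coneProj : ∀ a, lift (coneProj q τ a) = F a
    | .inl (x, s) => hcongr _ _ s (q_r (q x))
    | .inr () => rfl
  rw [← lift_coneProj, h, lift_coneProj]

end ConeOverQuotient

section Hemisphere

variable {E : Type*} [NormedAddCommGroup E] [NormedSpace ℝ E]

/-- The closed upper hemisphere of the unit sphere of `E × ℝ` as a cone over the equator, which is
the unit sphere of `E`; the parameter of the cone is the height. -/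
noncomputable def hemisphere :
    (Metric.sphere (0 : E) 1 × unitInterval) ⊕ Unit → Metric.sphere (0 : WithLp 2 (E × ℝ)) 1 :=
  Sum.elim
    (fun p => ⟨WithLp.toLp 2 (√(1 - p.2 ^ 2) • (p.1 : E), (p.2 : ℝ)), by
      have hp : 0 ≤ 1 - (p.2 : ℝ) ^ 2 := sub_nonneg.2 (pow_le_one₀ p.2.2.1 p.2.2.2)
      rw [mem_sphere_zero_iff_norm, ← sq_eq_sq₀ (norm_nonneg _) zero_le_one,
        WithLp.prod_norm_sq_eq_of_L2]
      simp [norm_smul, hp]⟩)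
    fun _ => ⟨WithLp.toLp 2 (0, 1), by
      rw [mem_sphere_zero_iff_norm, ← sq_eq_sq₀ (norm_nonneg _) zero_le_one,
        WithLp.prod_norm_sq_eq_of_L2]
      simp⟩

theorem hemisphere_inl_fst (x : Metric.sphere (0 : E) 1) (s : unitInterval) :
    (hemisphere (.inl (x, s))).1.fst = √(1 - s ^ 2) • (x : E) := rfl

theorem hemisphere_inl_snd (x : Metric.sphere (0 : E) 1) (s : unitInterval) :
    (hemisphere (.inl (x, s))).1.snd = s := rfl

theorem hemisphere_one (x : Metric.sphere (0 : E) 1) :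
    hemisphere (.inl (x, 1)) = hemisphere (.inr ()) :=
  Subtype.ext <| congrArg (WithLp.toLp 2) (by simp)

theorem continuous_hemisphere : Continuous (hemisphere (E := E)) := by
  unfold hemisphere
  fun_prop

theorem mem_range_hemisphere {p : Metric.sphere (0 : WithLp 2 (E × ℝ)) 1} (hp : 0 ≤ p.1.snd) :
    p ∈ Set.range hemisphere := by
  have norm_sq : ‖p.1.fst‖ ^ 2 + p.1.snd ^ 2 = 1 := by
    rw [← sq_abs p.1.snd, ← Real.norm_eq_abs, ← WithLp.prod_norm_sq_eq_of_L2,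
      norm_eq_of_mem_sphere, one_pow]
  by_cases h0 : p.1.fst = 0
  · have hsnd : p.1.snd = 1 := by
      rw [h0, norm_zero] at norm_sq
      nlinarith
    exact ⟨.inr (), Subtype.ext <| WithLp.ofLp_injective 2 <| Prod.ext h0.symm hsnd.symm⟩
  · have hfst : √(1 - p.1.snd ^ 2) = ‖p.1.fst‖ := by
      rw [← eq_sub_of_add_eq norm_sq, Real.sqrt_sq (norm_nonneg _)]
    refine ⟨.inl (⟨‖p.1.fst‖⁻¹ • p.1.fst, by simp [norm_smul, h0]⟩,
      ⟨p.1.snd, hp, by nlinarith [sq_nonneg ‖p.1.fst‖]⟩), 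
      Subtype.ext <| WithLp.ofLp_injective 2 <| Prod.ext ?_ rfl⟩
    change √(1 - p.1.snd ^ 2) • ‖p.1.fst‖⁻¹ • p.1.fst = p.1.fst
    rw [hfst, smul_inv_smul₀ (norm_ne_zero_iff.2 h0)]

theorem range_hemisphere_union_neg :
    Set.range (hemisphere (E := E)) ∪ Neg.neg '' Set.range hemisphere = Set.univ := by
  refine Set.eq_univ_of_forall fun p => (le_total 0 p.1.snd).imp mem_range_hemisphere fun h =>
    ⟨-p, mem_range_hemisphere (neg_nonneg.2 h), neg_neg p⟩

variable {G : Type*} [Group G] [DistribMulAction G E] [SMulCommClass G ℝ E] {Γ : Subgroup G}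
  {τ : OrbitSpace Γ (Metric.sphere (0 : E) 1) → OrbitSpace Γ (Metric.sphere (0 : E) 1)}

theorem coneProj_eq_of_hemisphere (hτ : ∀ x, τ (OrbitSpace.mk Γ x) = OrbitSpace.mk Γ (-x))
    {a b : (Metric.sphere (0 : E) 1 × unitInterval) ⊕ Unit}
    (h : ∃ g ∈ Γ,
      (g • (hemisphere b).1.fst = (hemisphere a).1.fst ∧
        (hemisphere b).1.snd = (hemisphere a).1.snd) ∨
      (g • (hemisphere b).1.fst = -(hemisphere a).1.fst ∧
        (hemisphere b).1.snd = -(hemisphere a).1.snd)) :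
    coneProj (OrbitSpace.mk Γ) τ a = coneProj (OrbitSpace.mk Γ) τ b := by
  obtain ⟨g, hg, h⟩ := h
  have snd_nonneg : ∀ c, 0 ≤ (hemisphere (E := E) c).1.snd
    | .inl (_, s) => s.2.1
    | .inr () => zero_le_one
  have snd_eq : (hemisphere b).1.snd = (hemisphere a).1.snd :=
    h.elim And.right fun h => by linarith [snd_nonneg a, snd_nonneg b, h.2]
  rcases a with ⟨x, s⟩ | ⟨⟩ <;> rcases b with ⟨y, t⟩ | ⟨⟩
  · obtain rfl : t = s := Subtype.ext snd_eq
    by_cases ht : t = 1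
    · rw [ht, coneProj_one, coneProj_one]
    simp only [hemisphere_inl_fst, smul_comm g, ← smul_neg] at h
    have height_ne_zero : √(1 - (t : ℝ) ^ 2) ≠ 0 :=
      Real.sqrt_ne_zero'.2 <| sub_pos.2 <|
        pow_lt_one₀ t.2.1 (lt_of_le_of_ne t.2.2 (Subtype.coe_ne_coe.2 ht)) two_ne_zero
    rcases h with h | h
    · have hgy : g • (y : E) = x := smul_right_injective E height_ne_zero h.1
      exact coneProj_congr ((OrbitSpace.mk_eq_mk Γ).2 ⟨g, hg, hgy⟩) t
    · have hgy : g • (y : E) = -x := smul_right_injective E height_ne_zero h.1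
      obtain rfl : t = 0 := Subtype.ext (self_eq_neg.1 h.2)
      exact (coneProj_zero hτ x).trans
        (coneProj_congr ((OrbitSpace.mk_eq_mk Γ).2 ⟨g, hg, hgy⟩) 0)
  · obtain rfl : s = 1 := Subtype.ext snd_eq.symm
    exact coneProj_one _ _ x
  · obtain rfl : t = 1 := Subtype.ext snd_eq
    exact (coneProj_one _ _ y).symm
  · rfl

/-- A quotient of the unit sphere of `E × ℝ` by the antipodal map and a group acting on `E` is a
quotient of the hemisphere, hence of the cone over the unit sphere of `E`. -/
noncomputable def homeomorphConeModBase [ProperSpace E] {Q : Type*} [TopologicalSpace Q]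
    {φ : Metric.sphere (0 : WithLp 2 (E × ℝ)) 1 → Q} (hφ : IsQuotientMap φ)
    (hΓ : ∀ g ∈ Γ, ∀ x : E, ‖g • x‖ = ‖x‖)
    (hτ : ∀ x, τ (OrbitSpace.mk Γ x) = OrbitSpace.mk Γ (-x))
    (hker : ∀ p p', φ p = φ p' ↔ ∃ g ∈ Γ, (g • p'.1.fst = p.1.fst ∧ p'.1.snd = p.1.snd) ∨
      (g • p'.1.fst = -p.1.fst ∧ p'.1.snd = -p.1.snd)) : Q ≃ₜ ConeModBase τ := by
  have isOpenQuotientMap_mk : IsOpenQuotientMap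
      (OrbitSpace.mk Γ : Metric.sphere (0 : E) 1 → OrbitSpace Γ (Metric.sphere (0 : E) 1)) := by
    refine OrbitSpace.isOpenQuotientMap_mk Γ (fun g hg => ?_) fun g hg x hx => ?_
    · exact (AddMonoidHomClass.isometry_of_norm (DistribSMul.toAddMonoidHom E g)
        (hΓ g hg)).continuous
    · rw [mem_sphere_zero_iff_norm] at hx ⊢
      rw [hΓ g hg, hx]
  have φ_neg (p) : φ (-p) = φ p := (hker _ _).2 ⟨1, one_mem Γ, Or.inr (by simp)⟩
  have φ_hemisphere : IsQuotientMap (φ ∘ hemisphere) :=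
    isQuotientMap_comp_of_range_union_image hφ (Homeomorph.neg _).isClosedMap φ_neg
      continuous_hemisphere continuous_hemisphere.isClosedMap range_hemisphere_union_neg
  refine quotientHomeomorph φ_hemisphere (isQuotientMap_coneProj isOpenQuotientMap_mk)
    fun a b => ⟨fun h => coneProj_eq_of_hemisphere hτ ((hker _ _).1 h), eq_of_coneProj_eq
      isOpenQuotientMap_mk.surjective hτ (fun x y s h => ?_) (fun x => ?_) fun x => ?_⟩
  · obtain ⟨g, hg, hgy⟩ := (OrbitSpace.mk_eq_mk Γ).1 h
    refine (hker _ _).2 ⟨g, hg, Or.inl ⟨?_, rfl⟩⟩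
    rw [hemisphere_inl_fst, hemisphere_inl_fst, smul_comm, hgy]
  · rw [Function.comp_apply, Function.comp_apply, hemisphere_one]
  · refine (hker _ _).2 ⟨1, one_mem Γ, Or.inr ⟨?_, ?_⟩⟩
    · rw [one_smul, hemisphere_inl_fst, hemisphere_inl_fst, ← smul_neg]
      rfl
    · simp [hemisphere_inl_snd]

end Hemisphere

section NegatedVectorsOdd

variable {n c m : ℕ}

/-- The complex coordinates in the first `m` blocks where `𝓡ₙʲ` is `-1`, `j = 2m + 1`, and the real
coordinate in the last one. -/
noncomputable def lensRealCoords {N : ℕ} (c m : ℕ) :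
    EuclideanSpace ℝ (Fin N) →ₗ[ℝ] WithLp 2 (EuclideanSpace ℂ (Fin m) × ℝ) :=
  (WithLp.linearEquiv 2 ℝ (EuclideanSpace ℂ (Fin m) × ℝ)).symm.toLinearMap ∘ₗ
    (lensCoords c m).prod (Complex.reLm ∘ₗ coord (antiBlock c m))

theorem coord_im_of_last_antiBlock (hc : c ≠ 0) (hn : n = 2 * (c * (2 * m + 1)))
    (X : EuclideanSpace ℝ (Fin (n - 1))) : (coord (antiBlock c m) X).im = 0 :=
  coord_im_of_last (by rw [hn, ← antiBlock_add_one hc]; ring) X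

theorem norm_lensRealCoords (hc : c ≠ 0) (hn : n = 2 * (c * (2 * m + 1)))
    {X : EuclideanSpace ℝ (Fin (n - 1))} (hX : (rot n ^ (2 * m + 1)) X = (-1 : ℝ) • X) :
    ‖lensRealCoords c m X‖ = ‖X‖ := by
  have half : (2 * m + 1 + 1) / 2 = m + 1 := by omega
  have norm_last : ‖coord (antiBlock c m) X‖ = ‖(coord (antiBlock c m) X).re‖ :=
    (Complex.abs_re_eq_norm.2 (coord_im_of_last_antiBlock hc hn X)).symm
  rw [← sq_eq_sq₀ (norm_nonneg _) (norm_nonneg _), WithLp.prod_norm_sq_eq_of_L2,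
    norm_sq_eq_sum_antiBlock hc (by omega) hn hX, half, Finset.sum_range_succ, norm_last,
    ← norm_sq_lensCoords]
  rfl

theorem exists_lensRealCoords_eq (hc : c ≠ 0) (hn : n = 2 * (c * (2 * m + 1)))
    (p : WithLp 2 (EuclideanSpace ℂ (Fin m) × ℝ)) :
    ∃ X : EuclideanSpace ℝ (Fin (n - 1)),
      (rot n ^ (2 * m + 1)) X = (-1 : ℝ) • X ∧ lensRealCoords c m X = p := by
  obtain ⟨X, hX, h⟩ := exists_coord_antiBlock_eq hc (by omega) hn
    (e := fun t => if h : t < m then p.fst ⟨t, h⟩ else p.snd) fun t ht => by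
      rw [dif_neg (by omega), Complex.ofReal_im]
  refine ⟨X, hX, WithLp.ofLp_injective 2 <| Prod.ext (PiLp.ext fun t => ?_) ?_⟩
  · exact (h t (by omega)).trans (dif_pos t.2)
  · refine (congrArg Complex.re (h m (by omega))).trans ?_
    rw [dif_neg (lt_irrefl m), Complex.ofReal_re]
    rfl

theorem lensRealCoords_fst_rot_zpow (hc : c ≠ 0) (hn : n = 2 * (c * (2 * m + 1))) (i : ℤ)
    (X : EuclideanSpace ℝ (Fin (n - 1))) :
    (lensRealCoords c m ((rot n ^ (2 * i)) X)).fst =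
      lensMap (2 * m + 1) (oddWeights m) ^ i • (lensRealCoords c m X).fst := by
  rw [zpow_mul, zpow_ofNat]
  refine apply_zpow_smul_of_semiconj (g := rot n ^ 2) (f := lensCoords c m) (fun X => ?_) i X
  exact lensCoords_rot_pow hc two_ne_zero (hn.trans (by ring)) X

theorem lensRealCoords_snd_rot_zpow (hc : c ≠ 0) (hn : n = 2 * (c * (2 * m + 1))) (i : ℤ)
    (X : EuclideanSpace ℝ (Fin (n - 1))) :
    (lensRealCoords c m ((rot n ^ (2 * i)) X)).snd = (lensRealCoords c m X).snd := by
  have zeta_pow : zeta n ^ ((antiBlock c m + 1) * 2) = 1 := by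
    rw [antiBlock_add_one hc, mul_comm, ← hn]
    exact (zeta_isPrimitiveRoot (by rw [hn]; positivity)).pow_eq_one
  have coord_rot_sq (X) : coord (antiBlock c m) ((rot n ^ 2) X) = coord (antiBlock c m) X := by
    rw [coord_rot_pow, zeta_pow, one_mul]
  rw [zpow_mul, zpow_ofNat]
  have h := apply_zpow_smul_of_semiconj (g := rot n ^ 2) (h := (1 : ℝˣ))
    (f := fun X => (coord (antiBlock c m) X).re)
    (fun X => (congrArg Complex.re (coord_rot_sq X)).trans (one_smul _ _).symm) i X
  rwa [one_zpow, one_smul] at h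

theorem norm_smul_of_mem_zpowers_lensMap {q : ℕ} {p : Fin m → ℤ}
    {g : EuclideanSpace ℂ (Fin m) ≃ₗ[ℂ] _} (hg : g ∈ Subgroup.zpowers (lensMap q p))
    (z : EuclideanSpace ℂ (Fin m)) : ‖g • z‖ = ‖z‖ := by
  have norm_lensMap (z : EuclideanSpace ℂ (Fin m)) : ‖lensMap q p • z‖ = ‖z‖ := by
    rw [← sq_eq_sq₀ (norm_nonneg _) (norm_nonneg _), EuclideanSpace.norm_sq_eq,
      EuclideanSpace.norm_sq_eq]
    refine Finset.sum_congr rfl fun t _ => ?_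
    have norm_factor : ‖Complex.exp (2 * Real.pi * Complex.I * (p t / q))‖ = 1 := by
      rw [show (2 * Real.pi * Complex.I * (p t / q) : ℂ) = (2 * Real.pi * (p t / q) : ℝ) * Complex.I
        by push_cast; ring, Complex.norm_exp_ofReal_mul_I]
    rw [← one_mul ‖z t‖, ← norm_factor, ← norm_mul]
    rfl
  obtain ⟨i, rfl⟩ := hg
  simpa using apply_zpow_smul_of_semiconj (g := lensMap q p) (h := (1 : ℝˣ)) (f := norm)
    (fun z => (norm_lensMap z).trans (one_smul _ _).symm) i z

/-- The negated vectors for `j = 2m + 1`: the last block where `𝓡ₙʲ` is `-1` is real, and `𝓡ₙ²`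
fixes it and acts on the complex ones as the lens map of order `j`. -/
noncomputable def negatedHomeomorphConeModBase (hc : c ≠ 0) (hn : n = 2 * (c * (2 * m + 1))) :
    OrbitSpace (rotGroup n) (eigenSphere (2 * m + 1) n (-1)) ≃ₜ
      ConeModBase (lensNeg (2 * m + 1) (oddWeights m)) :=
  have norm_eq (X : EuclideanSpace ℝ (Fin (n - 1)))
      (hX : (rot n ^ (2 * m + 1)) X = (-1 : ℝ) • X) : ‖lensRealCoords c m X‖ = ‖X‖ :=
    norm_lensRealCoords hc hn hX
  let Ψ := eigenSphereHomeomorph norm_eq (exists_lensRealCoords_eq hc hn)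
  homeomorphConeModBase (E := EuclideanSpace ℂ (Fin m))
    (Γ := Subgroup.zpowers (lensMap (2 * m + 1) (oddWeights m)))
    ((OrbitSpace.isQuotientMap_mk (rotGroup n) _).comp Ψ.symm.isQuotientMap)
    (fun g hg x => norm_smul_of_mem_zpowers_lensMap hg x) (fun _ => rfl)
    fun p p' => by
      obtain ⟨X, rfl⟩ := Ψ.surjective p
      obtain ⟨Y, rfl⟩ := Ψ.surjective p'
      have eq_iff {Z : EuclideanSpace ℝ (Fin (n - 1))}
          (hZ : (rot n ^ (2 * m + 1)) Z = (-1 : ℝ) • Z) (i : ℤ) :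
          Z = (rot n ^ (2 * i)) Y.1 ↔
            lensMap (2 * m + 1) (oddWeights m) ^ i • (lensRealCoords c m Y.1).fst =
              (lensRealCoords c m Z).fst ∧
            (lensRealCoords c m Y.1).snd = (lensRealCoords c m Z).snd := by
        rw [eq_comm, ← map_eq_map_iff norm_eq (rot_zpow_mem_eigenSphere Y.2 _).2 hZ,
          ← lensRealCoords_fst_rot_zpow hc hn, ← lensRealCoords_snd_rot_zpow hc hn i]
        exact (WithLp.ofLp_injective 2).eq_iff.symm.trans Prod.ext_iff
      simp only [Function.comp_apply, Homeomorph.symm_apply_apply]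
      rw [mk_eq_mk_iff_exists_sq_zpow (odd_two_mul_add_one m)]
      simp only [Subgroup.exists_mem_zpowers, Ψ, eigenSphereHomeomorph_val]
      refine exists_congr fun i => or_congr (eq_iff X.2.2 i) ?_
      rw [← neg_eq_iff_eq_neg, eq_iff (neg_mem_eigenSphere X.2).2 i, map_neg]
      rfl

end NegatedVectorsOdd

end NSegment

theorem mainTheorem7_general (n j k : ℕ) (hn : n ≠ 0) (hk : n = j * k) :
    (Odd k →
      Nonempty (NSegment.OrbitSpace (NSegment.rotGroup n) (NSegment.fixedLocus j n) ≃ₜ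
        NSegment.UnlabelledShapes j)) ∧
    (Even k → Even j →
      Nonempty (NSegment.OrbitSpace (NSegment.rotGroup n) (NSegment.fixedLocus j n) ≃ₜ
        NSegment.UnlabelledShapes j ⊕ NSegment.LensSpace (2 * j) (NSegment.oddWeights (j / 2)))) ∧
    (Even k → Odd j →
      Nonempty (NSegment.OrbitSpace (NSegment.rotGroup n) (NSegment.fixedLocus j n) ≃ₜ
        NSegment.UnlabelledShapes j ⊕
          NSegment.ConeModBase
            (NSegment.lensNeg j (NSegment.oddWeights ((j - 1) / 2))))) := by
  obtain ⟨hj, hk0⟩ : j ≠ 0 ∧ k ≠ 0 := mul_ne_zero_iff.1 (hk ▸ hn)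
  have fixed := NSegment.fixedHomeomorphUnlabelledShapes hn hj ⟨k, hk⟩
  have split := NSegment.fixedLocusHomeomorphSum j n
  refine ⟨fun hodd => ?_, fun ⟨c, hc⟩ ⟨m, hm⟩ => ?_, fun ⟨c, hc⟩ ⟨m, hm⟩ => ?_⟩
  · have := NSegment.isEmpty_eigenSphere_neg_one hn hk hodd
    exact ⟨(split.trans (.sumEmpty _ _)).trans fixed⟩
  · obtain rfl : j = 2 * m := hm.trans (two_mul m).symm
    rw [Nat.mul_div_cancel_left m two_pos]
    exact ⟨split.trans <| fixed.sumCongr <|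
      NSegment.negatedHomeomorphLensSpace (c := c) (by omega) (by omega) (by rw [hk, hc]; ring)⟩
  · subst hm
    rw [Nat.add_sub_cancel, Nat.mul_div_cancel_left m two_pos]
    exact ⟨split.trans <| fixed.sumCongr <|
      NSegment.negatedHomeomorphConeModBase (c := c) (by omega) (by rw [hk, hc]; ring)⟩

theorem mainTheorem7 (n j k : ℕ) (hn : 3 ≤ n) (hj : 0 < j) (hjn : j < n) (hk : n = j * k) :
    (Odd k →
      Nonempty (NSegment.OrbitSpace (NSegment.rotGroup n) (NSegment.fixedLocus j n) ≃ₜ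
        NSegment.UnlabelledShapes j)) ∧
    (Even k → Even j →
      Nonempty (NSegment.OrbitSpace (NSegment.rotGroup n) (NSegment.fixedLocus j n) ≃ₜ
        NSegment.UnlabelledShapes j ⊕ NSegment.LensSpace (2 * j) (NSegment.oddWeights (j / 2)))) ∧
    (Even k → Odd j →
      Nonempty (NSegment.OrbitSpace (NSegment.rotGroup n) (NSegment.fixedLocus j n) ≃ₜ
        NSegment.UnlabelledShapes j ⊕
          NSegment.ConeModBase
            (NSegment.lensNeg j (NSegment.oddWeights ((j - 1) / 2))))) :=
  mainTheorem7_general n j k (by omega) hk
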